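/- Let $A\in\mathbb R^{n\times n}$, $B\in\mathbb R^{n\times m}$, $K\in\mathbb R^{m\times n}$ and $G(\tau)=e^{A\tau}+\int_0^\tau e^{A(\tau-s)}BK\,ds$. A *cone* is a set $C\subseteq\mathbb R^n$ with $0\in C$ and $cx\in C$ for all $x\in C$, $c\ge 0$ (not necessarily convex). Let $R_1,\dots,R_r$ be cones that cover $\mathbb R^n$ and pairwise intersect only in $0$, and let $\tau_1,\dots,\tau_r$ be pairwise distinct real numbers (the inter-event times) such that $\ker G(\tau_j)^l\cap R_j=\{0\}$ for all $j\in\{1,\dots,r\}$ and $l\in\{1,\dots,n\}$. For $x\neq 0$ let the gamma map be $$\gamma(x)=\frac{G(\tau_j)x}{\|G(\tau_j)x\|},\qquad x\in R_j ,$$ with the Euclidean norm. This is the normalized event-to-event map of $\dot x(t)=Ax(t)+Bu(t)$, $u(t)=Kx(t_k)$ on $[t_k,t_{k+1})$, with $t_{k+1}-t_k=\tau_j$ if $x(t_k)\in R_j$. A set $T$ is positively invariant if $\gamma(x)\in T$ for all $x\in T\setminus\{0\}$; a positively invariant subset of $R_j$ is called a *PIS* in $R_j$. For $T\subseteq\mathbb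 R^n$ let $B_\varepsilon(T)$ be the set of points at distance at most $\varepsilon$ from $T$. $T$ is *stable* if for every $\varepsilon>0$ there is $\delta>0$ such that $\gamma^k(z)\in B_\varepsilon(T)$ for all $z\in B_\delta(T)$ and $k\ge 0$; *asymptotically stable* if it is stable and there is $\delta>0$ such that $\operatorname{dist}(\gamma^k(z),T)\to0$ for all $z\in B_\delta(T)$; *unstable* if there is $\varepsilon>0$ such that for every $\delta>0$ some $z\in B_\delta(T)$ and $k\ge0$ satisfy $\gamma^k(z)\notin B_\varepsilon(T)$. For $v\in\mathbb C^n$ let $\operatorname{rspan}(v)=\operatorname{span}_{\mathbb R}\{v+\bar v,\ \sqrt{-1}\,(v-\bar v)\}\subseteq\mathbb R^n$. An eigenvalue is defective if its geometric multiplicity is smaller than its algebraic multiplicity. $\sigma$ and $\rho$ denote the complex spectrum and the spectral radius. **Theorem.** Fix $i$, write $G=G(\tau_i)$, and suppose that $R_i$ is solid (has non-empty interior). Let $\bar R\subseteq R_i$ be a closed cone that is a PIS in $R_i$ and satisfies $\bar R\setminus\{0\}\subseteq\operatorname{int}R_i$. For $\lambda\in\sigma(G)$ let $$E_\lambda=\operatorname{span}_{\mathbb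 R}\bigcup\{\operatorname{rspan}(v): v\in\mathbb C^n,\ (G-\lambda I)^lv=0\text{ for some }l\in\mathbb N\},\quad \mathscr M=\bar R\cap E_\lambda,\quad \hat{\mathscr M}=\mathscr M\cap\{x:\|x\|=1\}.$$ Then $\mathscr M$ is a PIS in $R_i$, $\hat{\mathscr M}$ is positively invariant, and $\mathscr M\ne\{0\}$ if and only if $\hat{\mathscr M}\neq\emptyset$. If $\mathscr M\neq\{0\}$, then the following hold. 1. If $\lambda$ is non-defective, then $\hat{\mathscr M}$ is stable if and only if $|\lambda|=\rho(G)$ and every $q\in\sigma(G)\setminus\{\lambda,\bar\lambda\}$ with $|q|=|\lambda|$ is non-defective. 2. If $\lambda$ is defective, then $\hat{\mathscr M}$ is stable if and only if $|\lambda|=\rho(G)$, $E_\lambda\subseteq\mathscr M$, and $|q|<|\lambda|$ for all $q\in\sigma(G)\setminus\{\lambda,\bar\lambda\}$. 3. $\hat{\mathscr M}$ is asymptotically stable if and only if it is stable, $|q|<|\lambda|$ for all $q\in\sigma(G)\setminus\{\lambda,\bar\lambda\}$, and (a) $\operatorname{rspan}(v)\subseteq\mathscr M$ for every eigenvector $v\in\mathbb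 C^n$ of $G$ for $\lambda$, or (b) $\lambda$ is real and positive and has algebraic multiplicity one. 4. $\hat{\mathscr M}$ is unstable if and only if it is not stable. -/

import Mathlib

noncomputable section

namespace STC

/-- `G(τ) = e^{Aτ} + ∫₀^τ e^{A(τ-s)} B K ds`; the integral of the matrix is taken entrywise. -/
def stepMatrix {n m : ℕ} (A : Matrix (Fin n) (Fin n) ℝ) (B : Matrix (Fin n) (Fin m) ℝ)
    (K : Matrix (Fin m) (Fin n) ℝ) (τ : ℝ) : Matrix (Fin n) (Fin n) ℝ :=
  NormedSpace.exp (τ • A) +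
    Matrix.of fun a b => ∫ s in (0 : ℝ)..τ, (NormedSpace.exp ((τ - s) • A) * (B * K)) a b

/-- A (not necessarily convex) cone with apex at the origin; the apex belongs to the cone. -/
def IsCone {n : ℕ} (S : Set (EuclideanSpace ℝ (Fin n))) : Prop :=
  S.Nonempty ∧ ∀ x ∈ S, ∀ c : ℝ, 0 ≤ c → c • x ∈ S

/-- A linear system `ẋ = A x + B u` with the sampled feedback `u(t) = K x(t_k)` on `[t_k, t_{k+1})`
and the region-based self-triggering rule `t_{k+1} - t_k = τ i` if `x(t_k) ∈ R i`. The regions are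
cones which partition the state space, where distinct regions share the origin only. -/
structure System (n m r : ℕ) where
  A : Matrix (Fin n) (Fin n) ℝ
  B : Matrix (Fin n) (Fin m) ℝ
  K : Matrix (Fin m) (Fin n) ℝ
  R : Fin r → Set (EuclideanSpace ℝ (Fin n))
  τ : Fin r → ℝ
  isCone : ∀ i, IsCone (R i)
  cover : ∀ x, ∃ i, x ∈ R i
  disjoint : ∀ i j, i ≠ j → R i ∩ R j = {0}
  τ_injective : Function.Injective τ
  null_inter : ∀ i, ∀ l : ℕ, 1 ≤ l → l ≤ n →
    {x : EuclideanSpace ℝ (Fin n) | (stepMatrix A B K (τ i) ^ l).mulVec x.ofLp = 0} ∩ R i = {0}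

namespace System

variable {n m r : ℕ}

/-- The matrix `G(τ i)`. -/
def G (S : System n m r) (i : Fin r) : Matrix (Fin n) (Fin n) ℝ :=
  stepMatrix S.A S.B S.K (S.τ i)

/-- The index of a region containing `x`; it is unique when `x ≠ 0`. -/
def regionIndex (S : System n m r) (x : EuclideanSpace ℝ (Fin n)) : Fin r :=
  Classical.choose (S.cover x)

/-- The gamma map `γ(x) = G(τ i) x / ‖G(τ i) x‖`, `x ∈ R i`. Only its values at `x ≠ 0` matter. -/
def gamma (S : System n m r) (x : EuclideanSpace ℝ (Fin n)) : EuclideanSpace ℝ (Fin n) :=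
  let y : EuclideanSpace ℝ (Fin n) := WithLp.toLp 2 ((S.G (S.regionIndex x)).mulVec x.ofLp)
  ‖y‖⁻¹ • y

theorem gamma_of_mem (S : System n m r) {x : EuclideanSpace ℝ (Fin n)} (hx : x ≠ 0) {i : Fin r}
    (hi : x ∈ S.R i) :
    S.gamma x = ‖(WithLp.toLp 2 ((S.G i).mulVec x.ofLp) : EuclideanSpace ℝ (Fin n))‖⁻¹ •
      (WithLp.toLp 2 ((S.G i).mulVec x.ofLp) : EuclideanSpace ℝ (Fin n)) := by
  have h : S.regionIndex x = i := by
    by_contra hne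
    have hmem : x ∈ S.R (S.regionIndex x) ∩ S.R i := ⟨Classical.choose_spec (S.cover x), hi⟩
    rw [S.disjoint _ _ hne] at hmem
    exact hx hmem
  simp only [gamma, h]

/-- Positive invariance under the gamma map (which is undefined at the origin). -/
def PositivelyInvariant (S : System n m r) (T : Set (EuclideanSpace ℝ (Fin n))) : Prop :=
  ∀ x ∈ T, x ≠ 0 → S.gamma x ∈ T

/-- `T` is a positively invariant subregion of `R i`. -/
def IsPIS (S : System n m r) (i : Fin r) (T : Set (EuclideanSpace ℝ (Fin n))) : Prop :=
  T ⊆ S.R i ∧ S.PositivelyInvariant T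

end System

/-- The real matrix `M` regarded as a complex matrix. -/
def toComplex {n : ℕ} (M : Matrix (Fin n) (Fin n) ℝ) : Matrix (Fin n) (Fin n) ℂ :=
  M.map Complex.ofReal

/-- The real span of `v + v*` and `√-1 (v - v*)`, two vectors with real entries, in `ℝⁿ`. -/
def rspan {n : ℕ} (v : Fin n → ℂ) : Submodule ℝ (EuclideanSpace ℝ (Fin n)) :=
  Submodule.span ℝ
    {WithLp.toLp 2 fun j => (v j + (starRingEnd ℂ) (v j)).re,
      WithLp.toLp 2 fun j => (Complex.I * (v j - (starRingEnd ℂ) (v j))).re}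

theorem ofReal_rspan_generators (z : ℂ) :
    (((z + (starRingEnd ℂ) z).re : ℝ) : ℂ) = z + (starRingEnd ℂ) z ∧
    (((Complex.I * (z - (starRingEnd ℂ) z)).re : ℝ) : ℂ) =
      Complex.I * (z - (starRingEnd ℂ) z) := by
  constructor <;> apply Complex.ext <;> simp

/-- The real generalized eigenspace `span {rspan v : (M - μ I)^l v = 0, l ∈ ℕ}`. -/
def realGenEigenspace {n : ℕ} (M : Matrix (Fin n) (Fin n) ℝ) (μ : ℂ) :
    Submodule ℝ (EuclideanSpace ℝ (Fin n)) :=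
  ⨆ v ∈ {v : Fin n → ℂ | ∃ l : ℕ, 1 ≤ l ∧ ((toComplex M - μ • 1) ^ l).mulVec v = 0}, rspan v

/-- Algebraic multiplicity of `μ` as an eigenvalue of the real matrix `M`. -/
def algMult {n : ℕ} (M : Matrix (Fin n) (Fin n) ℝ) (μ : ℂ) : ℕ :=
  (toComplex M).charpoly.rootMultiplicity μ

/-- Geometric multiplicity of `μ` as an eigenvalue of the real matrix `M`. -/
def geomMult {n : ℕ} (M : Matrix (Fin n) (Fin n) ℝ) (μ : ℂ) : ℕ :=
  Module.finrank ℂ (Module.End.eigenspace (Matrix.toLin' (toComplex M)) μ)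

/-- `μ` is a defective eigenvalue of `M`. -/
def IsDefective {n : ℕ} (M : Matrix (Fin n) (Fin n) ℝ) (μ : ℂ) : Prop :=
  geomMult M μ < algMult M μ

/-- Stability of the set `T` under the iteration of `f`. `Metric.cthickening ε T` is the set
of the points at distance at most `ε` from `T`. -/
def IsStableSet {n : ℕ} (f : EuclideanSpace ℝ (Fin n) → EuclideanSpace ℝ (Fin n))
    (T : Set (EuclideanSpace ℝ (Fin n))) : Prop :=
  ∀ ε : ℝ, 0 < ε → ∃ δ : ℝ, 0 < δ ∧ ∀ z ∈ Metric.cthickening δ T, ∀ k : ℕ, f^[k] z ∈ Metric.cthickening ε T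

/-- Asymptotic stability: stability together with local attractivity. -/
def IsAsympStableSet {n : ℕ} (f : EuclideanSpace ℝ (Fin n) → EuclideanSpace ℝ (Fin n))
    (T : Set (EuclideanSpace ℝ (Fin n))) : Prop :=
  IsStableSet f T ∧ ∃ δ : ℝ, 0 < δ ∧ ∀ z ∈ Metric.cthickening δ T,
    Filter.Tendsto (fun k : ℕ => Metric.infDist (f^[k] z) T) Filter.atTop (nhds 0)

/-- Instability: orbits starting arbitrarily close to `T` leave a fixed neighbourhood of `T`. -/
def IsUnstableSet {n : ℕ} (f : EuclideanSpace ℝ (Fin n) → EuclideanSpace ℝ (Fin n))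
    (T : Set (EuclideanSpace ℝ (Fin n))) : Prop :=
  ∃ ε : ℝ, 0 < ε ∧ ∀ δ : ℝ, 0 < δ → ∃ z ∈ Metric.cthickening δ T, ∃ k : ℕ, f^[k] z ∉ Metric.cthickening ε T

end STC

end

namespace STC

open Filter Topology NormedSpace Metric Module

/-! Write `h` for `G / |λ|`. The compact set `M̂` lies in the open set `int R_i \ {0}`, where `γ` is
the normalization of `h`. An orbit of `γ` that stays near `M̂` is therefore the normalized orbit of
the linear map `h`, and all claims become claims about directions (`isStableSet_iff`,
`isAsympStableSet_iff`). If `M ≠ {0}` then `λ ≠ 0`, and space splits into invariant summands `E =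
E_λ` and `F`, the real parts of the generalized eigenspaces of the other eigenvalues.

Sufficiency is by estimates. If all eigenvalues of maximal modulus are non-defective, the powers of
`h` are bounded above, and bounded below on `E`, so directions near `M` stay near
(`linStable_of_bounded`). If `λ` strictly dominates, `F`-components decay geometrically relative to
`E`-components, so a direction whose `E`-component lies in `M` converges to `M` (`angDist_pow_le`).

Necessity rests on leading terms (`exists_hasLeadingTerm`). With `λ = u|λ|`, every nonzero `t = Re
v` in `E` satisfies `h^k t ~ C(k,p) y` along times with `u^k → 1`, where `y` is the real part of an
eigenvector; the backward orbit in `E` has the same leading term up to sign. So `M` contains such a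
`y`, whose orbit is bounded. Perturbing `y` within `F`, stability forces bounded orbits in `F`,
hence the spectral conditions. If `λ` is defective, perturbing `y` by a `t` with unbounded orbit
puts both signs of its leading direction into `M`; backward iterates of `t` start close to that
direction and end exactly at `t`, so `t` lies in `M`, and by density `E ⊆ M`. Adding a recurrent
vector of `F` to these backward iterates excludes other eigenvalues of modulus `|λ|`.

Attractivity forces recurrent directions near `M` to lie in `M`. This excludes recurrent vectors in
`F`; for non-defective `λ` with `dim E > 1`, connectedness of `E \ {0}` gives `E ⊆ M`. If `dim E =
1`, then `λ` is real and simple, and a negative `λ` makes `M` the whole line. -/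

theorem pow_apply_mem {R X : Type*} [Semiring R] [AddCommMonoid X] [Module R X]
    {h : Module.End R X} {A : Set X} (hA : ∀ x ∈ A, h x ∈ A) (k : ℕ) {x : X}
    (hx : x ∈ A) : (h ^ k) x ∈ A := by
  induction k with
  | zero => simpa using hx
  | succ k ih => rw [pow_succ', Module.End.mul_apply]; exact hA _ ih

/-! ### Directions under a linear map: sufficient conditions for stability and attractivity. -/

section Dynamics

variable {X : Type*} [NormedAddCommGroup X] [NormedSpace ℝ X]

/-- Multiplied by `‖m‖`, the difference is `(‖m‖ - ‖x‖)` times a vector of norm at most one plus `x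
- m`; each term costs `‖x - m‖`. The case `x = 0` is included, since `normalize 0 = 0`. -/
theorem norm_normalize_sub_normalize_le (x : X) {m : X} (hm : m ≠ 0) :
    ‖normalize x - normalize m‖ ≤ 2 * (‖x - m‖ / ‖m‖) := by
  have hm' : 0 < ‖m‖ := norm_pos_iff.2 hm
  have key : ‖m‖ • (normalize x - normalize m) = (‖m‖ - ‖x‖) • normalize x + (x - m) := by
    rw [smul_sub, norm_smul_normalize, sub_smul, norm_smul_normalize]; abel
  have h1 : ‖normalize x‖ ≤ 1 := by
    by_cases hx : x = 0
    · simp [hx]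
    · exact (norm_normalize hx).le
  have h2 : ‖m‖ * ‖normalize x - normalize m‖ ≤ 2 * ‖x - m‖ := by
    calc ‖m‖ * ‖normalize x - normalize m‖ = ‖‖m‖ • (normalize x - normalize m)‖ := by
          rw [norm_smul, norm_norm]
      _ ≤ ‖(‖m‖ - ‖x‖) • normalize x‖ + ‖x - m‖ := by rw [key]; exact norm_add_le _ _
      _ ≤ |‖m‖ - ‖x‖| * 1 + ‖x - m‖ := by
          rw [norm_smul, Real.norm_eq_abs]; gcongr
      _ ≤ 2 * ‖x - m‖ := by
          have := abs_norm_sub_norm_le m x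
          rw [norm_sub_rev] at this; linarith
  rw [← mul_div_assoc, le_div_iff₀ hm']; linarith

/-- The distance of the direction of `x` to the set of the directions in `M`. -/
noncomputable def angDist (M : Set X) (x : X) : ℝ := infDist (normalize x) (M ∩ sphere 0 1)

/-- Stability of the set of the directions in `M` under the projectivized linear map `h`. -/
def LinStable (h : Module.End ℝ X) (M : Set X) : Prop :=
  ∀ ε : ℝ, 0 < ε → ∃ δ : ℝ, 0 < δ ∧ ∀ x, angDist M x ≤ δ → ∀ k : ℕ, angDist M ((h ^ k) x) ≤ ε

/-- Attractivity of the set of the directions in `M` under the projectivized linear map `h`. -/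
def LinAttractive (h : Module.End ℝ X) (M : Set X) : Prop :=
  ∃ δ : ℝ, 0 < δ ∧ ∀ x, angDist M x ≤ δ → Tendsto (fun k : ℕ => angDist M ((h ^ k) x)) atTop (𝓝 0)

theorem angDist_nonneg (M : Set X) (x : X) : 0 ≤ angDist M x := infDist_nonneg

theorem angDist_smul (M : Set X) {c : ℝ} (hc : 0 < c) (x : X) : angDist M (c • x) = angDist M x := by
  rw [angDist, angDist, normalize_smul_of_pos hc]

/-- A closed cone `M` which is invariant under `h`, inside the first of two complementary
invariant subspaces. -/
structure InvariantCone (h : Module.End ℝ X) (E F : Submodule ℝ X) (M : Set X) : Prop where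
  isCompl : IsCompl E F
  mapE : ∀ x ∈ E, h x ∈ E
  mapF : ∀ x ∈ F, h x ∈ F
  inj : ∀ x ∈ E, h x = 0 → x = 0
  isClosed : IsClosed M
  smul_mem : ∀ x ∈ M, ∀ c : ℝ, 0 ≤ c → c • x ∈ M
  subset : M ⊆ E
  map : ∀ x ∈ M, h x ∈ M
  exists_ne : ∃ x ∈ M, x ≠ 0

namespace InvariantCone

variable {h : Module.End ℝ X} {E F : Submodule ℝ X} {M : Set X}

theorem normalize_mem (hM : InvariantCone h E F M) {x : X} (hx : x ∈ M) (h0 : x ≠ 0) :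
    normalize x ∈ M ∩ sphere 0 1 :=
  ⟨hM.smul_mem x hx _ (by positivity), by simpa using norm_normalize h0⟩

theorem nonempty (hM : InvariantCone h E F M) : (M ∩ sphere 0 1).Nonempty := by
  obtain ⟨x, hx, h0⟩ := hM.exists_ne
  exact ⟨_, hM.normalize_mem hx h0⟩

theorem isClosed_inter (hM : InvariantCone h E F M) : IsClosed (M ∩ sphere 0 1) :=
  hM.isClosed.inter isClosed_sphere

theorem pow_ne_zero (hM : InvariantCone h E F M) (k : ℕ) {x : X} (hx : x ∈ E) (h0 : x ≠ 0) :
    (h ^ k) x ≠ 0 := by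
  induction k with
  | zero => simpa using h0
  | succ k ih =>
    rw [pow_succ', Module.End.mul_apply]
    exact fun hk => ih (hM.inj _ (show _ ∈ (E : Set X) from pow_apply_mem hM.mapE k hx) hk)

theorem angDist_le (hM : InvariantCone h E F M) (x : X) {m : X} (hm : m ∈ M) (h0 : m ≠ 0) :
    angDist M x ≤ 2 * (‖x - m‖ / ‖m‖) :=
  (infDist_le_dist_of_mem (hM.normalize_mem hm h0)).trans
    (by rw [dist_eq_norm]; exact norm_normalize_sub_normalize_le x h0)

theorem angDist_eq_zero (hM : InvariantCone h E F M) {x : X} (hx : x ∈ M) (h0 : x ≠ 0) :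
    angDist M x = 0 :=
  le_antisymm (by simpa using hM.angDist_le x hx h0) (angDist_nonneg _ _)

theorem mem_of_angDist_eq_zero (hM : InvariantCone h E F M) {x : X} (hx : angDist M x = 0) :
    x ∈ M := by
  have h1 : normalize x ∈ M ∩ sphere 0 1 :=
    (hM.isClosed_inter.mem_iff_infDist_zero hM.nonempty).2 hx
  rw [← norm_smul_normalize x]
  exact hM.smul_mem _ h1.1 _ (norm_nonneg _)

theorem zero_mem (hM : InvariantCone h E F M) : (0 : X) ∈ M := by
  obtain ⟨x, hx, -⟩ := hM.exists_ne
  simpa using hM.smul_mem x hx 0 le_rfl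

theorem mem_of_forall_angDist_le (hM : InvariantCone h E F M) {x : X}
    (hx : ∀ ε > 0, angDist M x ≤ ε) : x ∈ M :=
  hM.mem_of_angDist_eq_zero (le_antisymm (le_of_forall_pos_le_add fun ε hε => by
    simpa using hx ε hε) (angDist_nonneg _ _))

/-- `normalize 0 = 0` has distance one from every unit vector. This is why thresholds below are
capped by `1 / 2`. -/
theorem ne_zero_of_angDist_lt (hM : InvariantCone h E F M) {x : X} (hx : angDist M x < 1) :
    x ≠ 0 := by
  rintro rfl
  refine hx.not_ge ((le_infDist hM.nonempty).2 fun y hy => ?_)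
  simpa using (mem_sphere_zero_iff_norm.1 hy.2).ge

theorem tendsto_angDist (M : Set X) {ι : Type*} {l : Filter ι} {f : ι → X} {y : X} (hy : y ≠ 0)
    (hf : Tendsto f l (𝓝 y)) : Tendsto (fun k => angDist M (f k)) l (𝓝 (angDist M y)) := by
  have hn : ContinuousAt (fun x : X => ‖x‖⁻¹ • x) y :=
    (continuousAt_id.norm.inv₀ (norm_ne_zero_iff.2 hy)).smul continuousAt_id
  exact ((continuous_infDist_pt (M ∩ sphere (0 : X) 1)).tendsto _).comp (hn.tendsto.comp hf)

theorem exists_near [ProperSpace X] (hM : InvariantCone h E F M) {x : X} {δ : ℝ}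
    (hx : angDist M x ≤ δ) : ∃ m ∈ M, ‖m‖ = 1 ∧ ‖normalize x - m‖ ≤ δ := by
  obtain ⟨m, hm, hd⟩ := hM.isClosed_inter.exists_infDist_eq_dist hM.nonempty (normalize x)
  refine ⟨m, hm.1, by simpa using hm.2, ?_⟩
  rw [← dist_eq_norm, ← hd]; exact hx

/-- Under domination, directions whose component in `E` belongs to `M` converge to `M`. -/
theorem angDist_pow_le (hM : InvariantCone h E F M) {C η : ℝ}
    (hdom : ∀ k, ∀ e ∈ E, ∀ f ∈ F, ‖(h ^ k) f‖ * ‖e‖ ≤ C * η ^ k * (‖(h ^ k) e‖ * ‖f‖))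
    {e f : X} (he : e ∈ M) (h0 : e ≠ 0) (hf : f ∈ F) (k : ℕ) :
    angDist M ((h ^ k) (e + f)) ≤ 2 * (C * η ^ k * (‖f‖ / ‖e‖)) := by
  have hk := hM.pow_ne_zero k (hM.subset he) h0
  refine (hM.angDist_le _ (pow_apply_mem hM.map k he) hk).trans ?_
  rw [map_add, add_sub_cancel_left]
  have h1 := hdom k e (hM.subset he) f hf
  have hp : 0 < ‖(h ^ k) e‖ := norm_pos_iff.2 hk
  have hp' : 0 < ‖e‖ := norm_pos_iff.2 h0
  gcongr
  rw [div_le_iff₀ hp, ← mul_le_mul_iff_left₀ hp']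
  calc _ ≤ _ := h1
    _ = _ := by field_simp

theorem exists_add (hM : InvariantCone h E F M) (x : X) : ∃ e ∈ E, ∃ f ∈ F, x = e + f := by
  have : x ∈ E ⊔ F := by rw [hM.isCompl.sup_eq_top]; trivial
  obtain ⟨e, he, f, hf, rfl⟩ := Submodule.mem_sup.1 this
  exact ⟨e, he, f, hf, rfl⟩

variable [FiniteDimensional ℝ X]

theorem exists_norm_le (A : Module.End ℝ X) : ∃ C : ℝ, 0 < C ∧ ∀ x, ‖A x‖ ≤ C * ‖x‖ := by
  obtain ⟨C, hC, h⟩ := (LinearMap.toContinuousLinearMap A).bound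
  exact ⟨C, hC, h⟩

/-- Directions close to those in `M` are dominated by their components in `E`. -/
theorem exists_component_bound (hM : InvariantCone h E F M) {κ : ℝ} (hκ : 0 < κ) :
    ∃ ε > 0, ∀ e ∈ E, ∀ f ∈ F, angDist M (e + f) ≤ ε → e ≠ 0 ∧ ‖f‖ ≤ κ * ‖e‖ := by
  have : ProperSpace X := FiniteDimensional.proper ℝ X
  obtain ⟨C, hC, hCb⟩ := exists_norm_le (E.projection F hM.isCompl)
  obtain ⟨D, hD, hDb⟩ := exists_norm_le (F.projection E hM.isCompl.symm)
  -- The first bound excludes `e + f = 0`. The second puts the normalized `E`-component within `1/2`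
  -- of a unit vector `m` of `M`, so its norm is at least `1/2`. The third bounds the normalized
  -- `F`-component by `κ/2`, as `m` has none.
  refine ⟨min (1 / 2) (min (1 / (2 * C)) (κ / (2 * D))), by positivity, fun e he f hf hle => ?_⟩
  have hx0 : e + f ≠ 0 := hM.ne_zero_of_angDist_lt
    (lt_of_le_of_lt (hle.trans (min_le_left _ _)) (by norm_num))
  obtain ⟨m, hm, hm1, hd⟩ := hM.exists_near hle
  have hn : 0 < ‖e + f‖ := norm_pos_iff.2 hx0
  set a : ℝ := ‖e + f‖⁻¹ with ha
  have ha0 : 0 < a := by positivity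
  have hnx : normalize (e + f) = a • e + a • f := by rw [NormedSpace.normalize, smul_add]
  have hPm : E.projection F hM.isCompl m = m :=
    Submodule.projection_apply_of_mem_left hM.isCompl (hM.subset hm)
  have hQm : F.projection E hM.isCompl.symm m = 0 :=
    (Submodule.projection_apply_eq_zero_iff hM.isCompl.symm).2 (hM.subset hm)
  have hPe : E.projection F hM.isCompl (normalize (e + f)) = a • e := by
    rw [hnx, map_add, Submodule.projection_apply_of_mem_left hM.isCompl (E.smul_mem a he),
      (Submodule.projection_apply_eq_zero_iff hM.isCompl).2 (F.smul_mem a hf), add_zero]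
  have hQf : F.projection E hM.isCompl.symm (normalize (e + f)) = a • f := by
    rw [hnx, map_add, (Submodule.projection_apply_eq_zero_iff hM.isCompl.symm).2 (E.smul_mem a he),
      Submodule.projection_apply_of_mem_left hM.isCompl.symm (F.smul_mem a hf), zero_add]
  have h1 := hCb (normalize (e + f) - m)
  have h2 := hDb (normalize (e + f) - m)
  rw [map_sub, hPm, hPe] at h1
  rw [map_sub, hQm, hQf, sub_zero] at h2
  have hd1 : ‖normalize (e + f) - m‖ ≤ 1 / (2 * C) :=
    hd.trans ((min_le_right _ _).trans (min_le_left _ _))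
  have hd2 : ‖normalize (e + f) - m‖ ≤ κ / (2 * D) :=
    hd.trans ((min_le_right _ _).trans (min_le_right _ _))
  have h3 : ‖a • e - m‖ ≤ 1 / 2 := h1.trans <| by
    calc C * ‖normalize (e + f) - m‖ ≤ C * (1 / (2 * C)) := by gcongr
      _ = 1 / 2 := by field_simp
  have h4 : ‖a • f‖ ≤ κ / 2 := h2.trans <| by
    calc D * ‖normalize (e + f) - m‖ ≤ D * (κ / (2 * D)) := by gcongr
      _ = κ / 2 := by field_simp
  have h5 : 1 / 2 ≤ ‖a • e‖ := by
    have := norm_sub_norm_le m (a • e)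
    rw [norm_sub_rev, hm1] at this; linarith
  rw [norm_smul, Real.norm_of_nonneg ha0.le] at h4 h5
  refine ⟨?_, ?_⟩
  · rintro rfl; simp at h5; linarith
  · have : a * ‖f‖ ≤ a * (κ * ‖e‖) := by nlinarith
    exact le_of_mul_le_mul_left this ha0

/-- `M` is stable if `h` is bounded and bounded from below on `M`. -/
theorem linStable_of_bounded (hM : InvariantCone h E F M) {C c : ℝ} (hc : 0 < c)
    (hC : ∀ k x, ‖(h ^ k) x‖ ≤ C * ‖x‖) (hcM : ∀ k, ∀ x ∈ M, c * ‖x‖ ≤ ‖(h ^ k) x‖) :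
    LinStable h M := by
  have : ProperSpace X := FiniteDimensional.proper ℝ X
  intro ε hε
  -- The orbit is compared with that of the nearest unit vector of `M`: the gap grows at most by
  -- `C`, the reference shrinks at most to `c`, and normalization costs a factor 2. `|C| + 1` is
  -- used because `C` need not be positive.
  refine ⟨min (1 / 2) (ε * c / (2 * (|C| + 1))), by positivity, fun x hx k => ?_⟩
  have hx0 : x ≠ 0 := hM.ne_zero_of_angDist_lt
    (lt_of_le_of_lt (hx.trans (min_le_left _ _)) (by norm_num))
  obtain ⟨m, hm, hm1, hd⟩ := hM.exists_near hx
  have hd' := hd.trans (min_le_right _ _)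
  have hn : 0 < ‖x‖⁻¹ := by positivity
  have h1 : angDist M ((h ^ k) x) = angDist M ((h ^ k) (normalize x)) := by
    rw [NormedSpace.normalize, map_smul, angDist_smul M hn]
  have hlow := hcM k m hm
  rw [hm1, mul_one] at hlow
  have hpos : 0 < ‖(h ^ k) m‖ := hc.trans_le hlow
  rw [h1]
  refine (hM.angDist_le _ (pow_apply_mem hM.map k hm) (norm_pos_iff.1 hpos)).trans ?_
  rw [← map_sub]
  have h2 : ‖(h ^ k) (normalize x - m)‖ ≤ (|C| + 1) * (ε * c / (2 * (|C| + 1))) := by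
    refine (hC k _).trans ?_
    have : C ≤ |C| + 1 := by linarith [le_abs_self C]
    gcongr
  have h3 : (|C| + 1) * (ε * c / (2 * (|C| + 1))) = ε * c / 2 := by field_simp
  rw [h3] at h2
  calc 2 * (‖(h ^ k) (normalize x - m)‖ / ‖(h ^ k) m‖) ≤ 2 * ((ε * c / 2) / c) := by gcongr
    _ = ε := by field_simp

/-- The component `e` itself lies in `M`, so its orbit serves as reference; the ratio of the two
components never exceeds `C` times its initial value. -/
theorem linStable_of_dominated (hM : InvariantCone h E F M) (hE : (E : Set X) ⊆ M) {C η : ℝ}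
    (hη0 : 0 ≤ η) (hη : η < 1)
    (hdom : ∀ k, ∀ e ∈ E, ∀ f ∈ F, ‖(h ^ k) f‖ * ‖e‖ ≤ C * η ^ k * (‖(h ^ k) e‖ * ‖f‖)) :
    LinStable h M := by
  intro ε hε
  obtain ⟨δ, hδ, hb⟩ := hM.exists_component_bound (κ := ε / (2 * (|C| + 1))) (by positivity)
  refine ⟨δ, hδ, fun x hx k => ?_⟩
  obtain ⟨e, he, f, hf, rfl⟩ := hM.exists_add x
  obtain ⟨h0, hfe⟩ := hb e he f hf hx
  refine (hM.angDist_pow_le hdom (hE he) h0 hf k).trans ?_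
  have hp' : 0 < ‖e‖ := norm_pos_iff.2 h0
  have h1 : ‖f‖ / ‖e‖ ≤ ε / (2 * (|C| + 1)) := by rwa [div_le_iff₀ hp']
  have h2 : C * η ^ k ≤ (|C| + 1) * 1 := by
    have := pow_le_one₀ hη0 hη.le (n := k)
    have h3 : C ≤ |C| + 1 := by linarith [le_abs_self C]
    have h4 : 0 ≤ η ^ k := by positivity
    calc C * η ^ k ≤ (|C| + 1) * η ^ k := by gcongr
      _ ≤ _ := by gcongr
  calc 2 * (C * η ^ k * (‖f‖ / ‖e‖)) ≤ 2 * ((|C| + 1) * 1 * (ε / (2 * (|C| + 1)))) := by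
        gcongr
    _ = ε := by field_simp

/-- The hypothesis `hE` is local so as to cover both `E ⊆ M` and the case where `M` is only one ray
of a line `E`. -/
theorem linAttractive_of_dominated (hM : InvariantCone h E F M) {δ : ℝ} (hδ : 0 < δ)
    (hE : ∀ e ∈ E, ∀ f ∈ F, angDist M (e + f) ≤ δ → e ∈ M) {C η : ℝ}
    (hη0 : 0 ≤ η) (hη : η < 1)
    (hdom : ∀ k, ∀ e ∈ E, ∀ f ∈ F, ‖(h ^ k) f‖ * ‖e‖ ≤ C * η ^ k * (‖(h ^ k) e‖ * ‖f‖)) :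
    LinAttractive h M := by
  obtain ⟨δ', hδ', hb⟩ := hM.exists_component_bound (κ := 1) one_pos
  refine ⟨min δ δ', by positivity, fun x hx => ?_⟩
  obtain ⟨e, he, f, hf, rfl⟩ := hM.exists_add x
  obtain ⟨h0, -⟩ := hb e he f hf (hx.trans (min_le_right _ _))
  have heM := hE e he f hf (hx.trans (min_le_left _ _))
  refine squeeze_zero (fun _ => angDist_nonneg _ _) (hM.angDist_pow_le hdom heM h0 hf) ?_
  have := ((tendsto_pow_atTop_nhds_zero_of_lt_one hη0 hη).const_mul C).mul_const (‖f‖ / ‖e‖)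
  simpa using this.const_mul 2

/-- If `E` is a line, then components in `E` of directions close to those in `M` lie in `M`. -/
theorem exists_component_mem (hM : InvariantCone h E F M)
    (hE : ∀ m ∈ E, m ≠ 0 → ∀ e ∈ E, ∃ c : ℝ, e = c • m) :
    ∃ δ > 0, ∀ e ∈ E, ∀ f ∈ F, angDist M (e + f) ≤ δ → e ∈ M := by
  have : ProperSpace X := FiniteDimensional.proper ℝ X
  obtain ⟨C, hC, hCb⟩ := exists_norm_le (E.projection F hM.isCompl)
  refine ⟨min (1 / 2) (1 / (2 * C)), by positivity, fun e he f hf hle => ?_⟩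
  have hx0 : e + f ≠ 0 := hM.ne_zero_of_angDist_lt
    (lt_of_le_of_lt (hle.trans (min_le_left _ _)) (by norm_num))
  obtain ⟨m, hm, hm1, hd⟩ := hM.exists_near hle
  have hm0 : m ≠ 0 := by rintro rfl; simp at hm1
  obtain ⟨b, rfl⟩ := hE m (hM.subset hm) hm0 e he
  -- Only the sign of `b` matters. The normalized `E`-component is `a b m` with `a > 0`, and `|a b -
  -- 1| ≤ 1/2` excludes `b < 0`.
  refine hM.smul_mem m hm b ?_
  have hn : 0 < ‖b • m + f‖ := norm_pos_iff.2 hx0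
  set a : ℝ := ‖b • m + f‖⁻¹ with ha
  have ha0 : 0 < a := by positivity
  have hnx : normalize (b • m + f) = a • b • m + a • f := by rw [NormedSpace.normalize, smul_add]
  have hPm : E.projection F hM.isCompl m = m :=
    Submodule.projection_apply_of_mem_left hM.isCompl (hM.subset hm)
  have hPe : E.projection F hM.isCompl (normalize (b • m + f)) = a • b • m := by
    rw [hnx, map_add, Submodule.projection_apply_of_mem_left hM.isCompl (E.smul_mem a he),
      (Submodule.projection_apply_eq_zero_iff hM.isCompl).2 (F.smul_mem a hf), add_zero]
  have h1 := hCb (normalize (b • m + f) - m)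
  rw [map_sub, hPm, hPe] at h1
  have h3 : ‖a • b • m - m‖ ≤ 1 / 2 := h1.trans <| by
    calc C * ‖normalize (b • m + f) - m‖ ≤ C * (1 / (2 * C)) := by
          gcongr; exact hd.trans (min_le_right _ _)
      _ = 1 / 2 := by field_simp
  have h4 : a • b • m - m = (a * b - 1) • m := by rw [sub_smul, mul_smul, one_smul]
  rw [h4, norm_smul, hm1, mul_one, Real.norm_eq_abs, abs_le] at h3
  by_contra hb
  nlinarith [mul_pos ha0 (neg_pos.2 (not_le.1 hb))]

end InvariantCone

end Dynamics

/-! ### Necessary conditions for stability and attractivity, from leading terms and recurrence. -/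

section Dynamics

variable {X : Type*} [NormedAddCommGroup X] [NormedSpace ℝ X]

/-- The orbit of `x` under the powers of `h` is bounded. -/
def BoundedOrbit (h : Module.End ℝ X) (x : X) : Prop := ∃ C : ℝ, ∀ k : ℕ, ‖(h ^ k) x‖ ≤ C

theorem BoundedOrbit.add {h : Module.End ℝ X} {x y : X} (hx : BoundedOrbit h x)
    (hy : BoundedOrbit h y) : BoundedOrbit h (x + y) := by
  obtain ⟨C, hC⟩ := hx
  obtain ⟨D, hD⟩ := hy
  exact ⟨C + D, fun k => by rw [map_add]; exact norm_add_le_of_le (hC k) (hD k)⟩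

theorem BoundedOrbit.smul {h : Module.End ℝ X} {x : X} (hx : BoundedOrbit h x) (c : ℝ) :
    BoundedOrbit h (c • x) := by
  obtain ⟨C, hC⟩ := hx
  exact ⟨‖c‖ * C, fun k => by rw [map_smul, norm_smul]; gcongr; exact hC k⟩

/-- `y` is the recurrent leading term of the forward orbit and, up to sign, of the backward orbit
of `t` inside `E` along the times in `l`, after division by the growth rate `c`. -/
structure HasLeadingTerm (h : Module.End ℝ X) (E : Submodule ℝ X) (l : Filter ℕ) (t y : X)
    (c : ℕ → ℝ) : Prop where
  mem : y ∈ E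
  ne_zero : y ≠ 0
  bounded : BoundedOrbit h y
  recurrent : Tendsto (fun k => (h ^ k) y) l (𝓝 y)
  pos : ∀ᶠ k in l, 0 < c k
  forward : Tendsto (fun k => (c k)⁻¹ • (h ^ k) t) l (𝓝 y)
  backward : ∃ s : ℕ → X, (∀ k, s k ∈ E ∧ (h ^ k) (s k) = t) ∧
    (Tendsto (fun k => (c k)⁻¹ • s k) l (𝓝 y) ∨ Tendsto (fun k => (c k)⁻¹ • s k) l (𝓝 (-y)))
  growth : BoundedOrbit h t ∨ Tendsto c l atTop

namespace InvariantCone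

variable {h : Module.End ℝ X} {E F : Submodule ℝ X} {M : Set X}

theorem mem_of_hasLeadingTerm (hM : InvariantCone h E F M) {l : Filter ℕ} [l.NeBot] {t y : X}
    {c : ℕ → ℝ} (ht : t ∈ M) (hL : HasLeadingTerm h E l t y c) : y ∈ M := by
  refine hM.isClosed.mem_of_tendsto hL.forward ?_
  filter_upwards [hL.pos] with k hk
  exact hM.smul_mem _ (pow_apply_mem hM.map k ht) _ (by positivity)

theorem angDist_add_smul_le (hM : InvariantCone h E F M) {y : X} (hy : y ∈ M) (hy0 : y ≠ 0) (w : X)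
    {δ : ℝ} (hδ : 0 < δ) : ∃ s : ℝ, 0 < s ∧ angDist M (y + s • w) ≤ δ := by
  have hp : 0 < ‖y‖ := norm_pos_iff.2 hy0
  refine ⟨δ * ‖y‖ / (2 * (‖w‖ + 1)), by positivity, ?_⟩
  refine (hM.angDist_le _ hy hy0).trans ?_
  rw [add_sub_cancel_left, norm_smul, Real.norm_of_nonneg (by positivity)]
  calc 2 * (δ * ‖y‖ / (2 * (‖w‖ + 1)) * ‖w‖ / ‖y‖)
      = δ * (‖w‖ / (‖w‖ + 1)) := by field_simp
    _ ≤ δ * 1 := by gcongr; exact (div_le_one (by positivity)).2 (by linarith)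
    _ = δ := mul_one δ

/-- For small `s` the vector `y + s w` starts near `M`. Stability keeps it where the `F`-component
`s h^k w` is at most the `E`-component `h^k y`, which is bounded. -/
theorem boundedOrbit_of_linStable [FiniteDimensional ℝ X] (hM : InvariantCone h E F M)
    (hs : LinStable h M) {y : X} (hy : y ∈ M) (hy0 : y ≠ 0) (hb : BoundedOrbit h y) {w : X}
    (hw : w ∈ F) : BoundedOrbit h w := by
  obtain ⟨ε, hε, hcomp⟩ := hM.exists_component_bound one_pos
  obtain ⟨δ, hδ, hst⟩ := hs ε hε
  obtain ⟨s, hs0, hle⟩ := hM.angDist_add_smul_le hy hy0 w hδ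
  obtain ⟨C, hC⟩ := hb
  refine ⟨s⁻¹ * C, fun k => ?_⟩
  have h1 := hst _ hle k
  rw [map_add] at h1
  have h2 := (hcomp _ (show _ ∈ (E : Set X) from pow_apply_mem hM.mapE k (hM.subset hy)) _
    (show _ ∈ (F : Set X) from pow_apply_mem hM.mapF k (F.smul_mem s hw)) h1).2
  rw [map_smul, norm_smul, Real.norm_of_nonneg hs0.le, one_mul] at h2
  rw [← div_eq_inv_mul, le_div_iff₀' hs0]
  exact h2.trans (hC k)

/-- The vector `y + s t` starts near `M`; since the orbit of `y` is bounded and `c → ∞`, its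
direction tends to that of `z`. Stability puts this limit within every `ε` of `M`. -/
theorem leadingTerm_mem_of_linStable (hM : InvariantCone h E F M)
    (hs : LinStable h M) {y : X} (hy : y ∈ M) (hy0 : y ≠ 0) (hb : BoundedOrbit h y)
    {l : Filter ℕ} [l.NeBot] {t z : X} {c : ℕ → ℝ} (hz : z ≠ 0) (hc : Tendsto c l atTop)
    (hf : Tendsto (fun k => (c k)⁻¹ • (h ^ k) t) l (𝓝 z)) : z ∈ M := by
  refine hM.mem_of_forall_angDist_le fun ε hε => ?_
  obtain ⟨δ, hδ, hst⟩ := hs ε hε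
  obtain ⟨s, hs0, hle⟩ := hM.angDist_add_smul_le hy hy0 t hδ
  obtain ⟨C, hC⟩ := hb
  have h0 : Tendsto (fun k => (c k)⁻¹ • (h ^ k) y) l (𝓝 0) := by
    rw [tendsto_zero_iff_norm_tendsto_zero]
    refine squeeze_zero' (Eventually.of_forall fun _ => norm_nonneg _)
      (g := fun k => (c k)⁻¹ * C) ?_ (by simpa using (tendsto_inv_atTop_zero.comp hc).mul_const C)
    filter_upwards [hc.eventually_gt_atTop 0] with k hk
    rw [norm_smul, Real.norm_of_nonneg (by positivity)]
    gcongr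
    exact hC k
  have h1 : Tendsto (fun k => (c k)⁻¹ • (h ^ k) (y + s • t)) l (𝓝 (s • z)) := by
    have := h0.add (hf.const_smul s)
    rw [zero_add] at this
    refine this.congr fun k => ?_
    rw [map_add, map_smul, smul_add, smul_comm s]
  rw [← angDist_smul M hs0]
  refine le_of_tendsto (tendsto_angDist M (smul_ne_zero hs0.ne' hz) h1) ?_
  filter_upwards [hc.eventually_gt_atTop 0] with k hk
  rw [angDist_smul M (by positivity)]
  exact hst _ hle k

/-- A stable cone contains every vector of `E` with an unbounded orbit. -/
theorem mem_of_linStable_of_unbounded (hM : InvariantCone h E F M)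
    (hs : LinStable h M) {y : X} (hy : y ∈ M) (hy0 : y ≠ 0) (hb : BoundedOrbit h y)
    {l : Filter ℕ} [l.NeBot] {t z : X} {c : ℕ → ℝ} (hL : HasLeadingTerm h E l t z c)
    (hub : ¬ BoundedOrbit h t) : t ∈ M := by
  have hc := hL.growth.resolve_left hub
  have hz : z ∈ M := hM.leadingTerm_mem_of_linStable hs hy hy0 hb hL.ne_zero hc hL.forward
  -- The backward limit is known only up to sign, so both signs are needed in `M`.
  have hz' : -z ∈ M := by
    refine hM.leadingTerm_mem_of_linStable (t := -t) hs hy hy0 hb (neg_ne_zero.2 hL.ne_zero) hc ?_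
    simpa using hL.forward.neg
  obtain ⟨s, hsE, hlim⟩ := hL.backward
  have key : ∀ z' ∈ M, z' ≠ 0 → Tendsto (fun k => (c k)⁻¹ • s k) l (𝓝 z') → t ∈ M := by
    intro z' hz' hz0' hlim'
    refine hM.mem_of_forall_angDist_le fun ε hε => ?_
    -- Some `s k` is `δ`-close to `M` in direction, and its orbit reaches `t` exactly after `k`
    -- steps, so `t` is `ε`-close to `M`.
    obtain ⟨δ, hδ, hst⟩ := hs ε hε
    have h1 := tendsto_angDist M hz0' hlim'
    rw [hM.angDist_eq_zero hz' hz0'] at h1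
    obtain ⟨k, hk, hck⟩ := ((h1.eventually (ge_mem_nhds hδ)).and hL.pos).exists
    rw [angDist_smul M (by positivity)] at hk
    have := hst _ hk k
    rwa [(hsE k).2] at this
  rcases hlim with hlim | hlim
  · exact key z hz hL.ne_zero hlim
  · exact key (-z) hz' (neg_ne_zero.2 hL.ne_zero) hlim

/-- A stable cone is all of `E` if `E` contains an unbounded orbit. -/
theorem subset_of_linStable_of_unbounded (hM : InvariantCone h E F M) (hs : LinStable h M)
    {l : Filter ℕ} [l.NeBot] (hL : ∀ t ∈ E, t ≠ 0 → ∃ z c, HasLeadingTerm h E l t z c)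
    {t₀ : X} (ht₀ : t₀ ∈ E) (hub : ¬ BoundedOrbit h t₀) : (E : Set X) ⊆ M := by
  obtain ⟨x, hx, hx0⟩ := hM.exists_ne
  obtain ⟨y, cy, hy⟩ := hL x (hM.subset hx) hx0
  have hyM := hM.mem_of_hasLeadingTerm hx hy
  have key : ∀ t ∈ E, ¬ BoundedOrbit h t → t ∈ M := by
    intro t ht htu
    have ht0 : t ≠ 0 := by
      rintro rfl
      exact htu ⟨0, fun k => by simp⟩
    obtain ⟨z, c, hz⟩ := hL t ht ht0
    exact hM.mem_of_linStable_of_unbounded hs hyM hy.ne_zero hy.bounded hz htu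
  intro t ht
  by_cases htb : BoundedOrbit h t
  -- A vector with bounded orbit is the limit of `t + s t₀` as `s → 0+`, and these have unbounded
  -- orbits because `t₀` has.
  · have hlim : Tendsto (fun s : ℝ => t + s • t₀) (𝓝[>] 0) (𝓝 t) := by
      have hcont : Continuous (fun s : ℝ => t + s • t₀) := by fun_prop
      simpa using (hcont.tendsto 0).mono_left nhdsWithin_le_nhds
    refine hM.isClosed.mem_of_tendsto hlim ?_
    filter_upwards [self_mem_nhdsWithin] with s hs0
    have hs0' : s ≠ 0 := (Set.mem_Ioi.1 hs0).ne'
    refine key _ (E.add_mem ht (E.smul_mem s ht₀)) fun hbd => hub ?_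
    have := (hbd.add (htb.smul (-1))).smul s⁻¹
    have h2 : s⁻¹ • (t + s • t₀ + (-1 : ℝ) • t) = t₀ := by
      rw [neg_one_smul, add_neg_cancel_comm, smul_smul, inv_mul_cancel₀ hs0', one_smul]
    rwa [h2] at this
  · exact key t ht htb

/-- If a stable cone is all of `E` and `E` contains an unbounded orbit, then no nonzero vector
in `F` is recurrent. -/
theorem eq_zero_of_recurrent_of_unbounded (hM : InvariantCone h E F M) (hs : LinStable h M)
    (hE : (E : Set X) ⊆ M) {l : Filter ℕ} [l.NeBot] {t z w : X} {c : ℕ → ℝ} (ht : t ∈ E)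
    (hL : HasLeadingTerm h E l t z c) (hub : ¬ BoundedOrbit h t) (hw : w ∈ F)
    (hrec : Tendsto (fun k => (h ^ k) w) l (𝓝 w)) : w = 0 := by
  have hc := hL.growth.resolve_left hub
  by_contra hw0
  have hsum : ∀ {e f : X}, e ∈ E → f ∈ F → e + f ∈ E → f = 0 := fun {e f} he hf hef =>
    (Submodule.disjoint_def.1 hM.isCompl.disjoint) f
      (by simpa using E.sub_mem hef he) hf
  obtain ⟨s, hsE, hlim⟩ := hL.backward
  obtain ⟨z', hz0, hzM, hlim'⟩ : ∃ z', z' ≠ 0 ∧ z' ∈ M ∧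
      Tendsto (fun k => (c k)⁻¹ • s k) l (𝓝 z') := by
    rcases hlim with hlim | hlim
    · exact ⟨z, hL.ne_zero, hE hL.mem, hlim⟩
    · exact ⟨-z, neg_ne_zero.2 hL.ne_zero, hE (E.neg_mem hL.mem), hlim⟩
  have htw : t + w ∈ M := by
    have htw0 : t + w ≠ 0 := fun h0 => hw0 (hsum ht hw (by rw [h0]; exact E.zero_mem))
    refine hM.mem_of_forall_angDist_le fun ε hε => ?_
    obtain ⟨δ, hδ, hst⟩ := hs ε hε
    -- At the start `w` is negligible against `s k`, so the direction is near `M`; at the end `h^k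
    -- (s k + w) = t + h^k w` is near `t + w`. Stability then yields `t + w ∈ M`.
    have h1 : Tendsto (fun k => (c k)⁻¹ • (s k + w)) l (𝓝 z') := by
      have := hlim'.add ((tendsto_inv_atTop_zero.comp hc).smul_const w)
      rw [zero_smul, add_zero] at this
      exact this.congr fun k => by simp [smul_add]
    have h2 := tendsto_angDist M hz0 h1
    rw [hM.angDist_eq_zero hzM hz0] at h2
    have h3 : Tendsto (fun k => (h ^ k) (s k + w)) l (𝓝 (t + w)) := by
      refine (hrec.const_add t).congr fun k => ?_
      rw [map_add, (hsE k).2]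
    refine le_of_tendsto (tendsto_angDist M htw0 h3) ?_
    filter_upwards [h2.eventually (ge_mem_nhds hδ), hL.pos] with k hk hck
    rw [angDist_smul M (by positivity)] at hk
    exact hst _ hk k
  exact hw0 (hsum ht hw (hM.subset htw))

/-- Along `l` the angular distance tends both to that of `x` and to zero. -/
theorem mem_of_recurrent (hM : InvariantCone h E F M) {l : Filter ℕ} [l.NeBot]
    (hl : l ≤ atTop) {x : X} (hx : x ≠ 0) (hrec : Tendsto (fun k => (h ^ k) x) l (𝓝 x))
    (hx' : Tendsto (fun k : ℕ => angDist M ((h ^ k) x)) atTop (𝓝 0)) : x ∈ M :=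
  hM.mem_of_angDist_eq_zero
    (tendsto_nhds_unique (tendsto_angDist M hx hrec) (hx'.mono_left hl))

/-- An attractive cone excludes recurrent vectors in `F`. -/
theorem eq_zero_of_recurrent_of_attractive (hM : InvariantCone h E F M) (ha : LinAttractive h M)
    {l : Filter ℕ} [l.NeBot] (hl : l ≤ atTop)
    (hL : ∀ t ∈ E, t ≠ 0 → ∃ z c, HasLeadingTerm h E l t z c) {w : X} (hw : w ∈ F)
    (hrec : Tendsto (fun k => (h ^ k) w) l (𝓝 w)) : w = 0 := by
  by_contra hw0
  obtain ⟨x, hx, hx0⟩ := hM.exists_ne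
  obtain ⟨y, cy, hy⟩ := hL x (hM.subset hx) hx0
  have hyM := hM.mem_of_hasLeadingTerm hx hy
  obtain ⟨δ, hδ, hatt⟩ := ha
  obtain ⟨s, hs0, hle⟩ := hM.angDist_add_smul_le hyM hy.ne_zero w hδ
  have hsum : y + s • w ∈ E → s • w = 0 := fun hef =>
    (Submodule.disjoint_def.1 hM.isCompl.disjoint) _
      (by simpa using E.sub_mem hef hy.mem) (F.smul_mem s hw)
  have hsw : s • w ≠ 0 := smul_ne_zero hs0.ne' hw0
  -- The sum `y + s w` is recurrent and near `M`, hence in `M ⊆ E`; this forces `s w = 0`.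
  refine hsw (hsum (hM.subset (hM.mem_of_recurrent hl (fun h0 => hsw (hsum ?_)) ?_ (hatt _ hle))))
  · rw [h0]; exact E.zero_mem
  · refine (hy.recurrent.add (hrec.const_smul s)).congr fun k => ?_
    rw [map_add, map_smul]

/-- If all vectors in `E` are recurrent, an attractive cone is `E`, unless `E` is a line. -/
theorem subset_of_attractive [FiniteDimensional ℝ X] (hM : InvariantCone h E F M)
    (ha : LinAttractive h M)
    {l : Filter ℕ} [l.NeBot] (hl : l ≤ atTop)
    (hrec : ∀ t ∈ E, Tendsto (fun k => (h ^ k) t) l (𝓝 t)) (hE : 1 < Module.finrank ℝ E) :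
    (E : Set X) ⊆ M := by
  obtain ⟨δ, hδ, hatt⟩ := ha
  -- In `E \ {0}` the closed set `M` agrees with the open set of angular distance below `δ`, because
  -- recurrent attracted vectors lie in `M`. Connectedness leaves only `M = E`.
  have hconn : IsPreconnected ({0}ᶜ : Set E) :=
    (isConnected_compl_singleton_of_one_lt_rank
      (by rw [← Module.finrank_eq_rank]; exact_mod_cast hE) 0).isPreconnected
  have hcl : IsClosed {e : E | (e : X) ∈ M} := hM.isClosed.preimage continuous_subtype_val
  have hmem : ∀ e ∈ E, e ≠ 0 → angDist M e ≤ δ → e ∈ M := fun e he h0 hle =>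
    hM.mem_of_recurrent hl h0 (hrec e he) (hatt e hle)
  have hcont : ContinuousOn (fun e : E => angDist M (e : X)) {0}ᶜ := fun e he =>
    (tendsto_angDist M (f := fun e : E => (e : X)) (by simpa using he)
      (continuous_subtype_val.tendsto e)).mono_left nhdsWithin_le_nhds
  have hop : IsOpen ({0}ᶜ ∩ (fun e : E => angDist M (e : X)) ⁻¹' Set.Iio δ) :=
    hcont.isOpen_inter_preimage isOpen_compl_singleton isOpen_Iio
  obtain ⟨x, hx, hx0⟩ := hM.exists_ne
  intro e he
  by_cases he0 : e = 0
  · rw [he0]; exact hM.zero_mem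
  by_contra hne
  obtain ⟨e', he'0, ⟨⟨-, he'1⟩, he'2⟩⟩ := hconn _ _ hop hcl.isOpen_compl
    (fun e' he' => by
      by_cases h1 : (e' : X) ∈ M
      · left
        refine ⟨he', ?_⟩
        rw [Set.mem_preimage, hM.angDist_eq_zero h1 (by simpa using he')]
        exact hδ
      · right; exact h1)
    ⟨⟨x, hM.subset hx⟩, by simpa using hx0, by simpa using hx0, by
      rw [Set.mem_preimage, hM.angDist_eq_zero hx hx0]; exact hδ⟩
    ⟨⟨e, he⟩, by simpa using he0, hne⟩
  exact he'2 (hmem _ e'.2 (by simpa using he'0) (Set.mem_Iio.1 he'1).le)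

end InvariantCone

end Dynamics

/-! ### Real generalized eigenspaces as real parts of complex ones. -/

section Complexification

variable {n : ℕ}

/-- A real matrix as an endomorphism of `ℝⁿ`. -/
noncomputable def realEnd (G : Matrix (Fin n) (Fin n) ℝ) : End ℝ (EuclideanSpace ℝ (Fin n)) :=
  Matrix.toLpLin 2 2 G

/-- A real matrix as an endomorphism of `ℂⁿ`. -/
noncomputable def complexEnd (G : Matrix (Fin n) (Fin n) ℝ) : End ℂ (Fin n → ℂ) :=
  Matrix.toLin' (toComplex G)

/-- The entrywise real part. -/
def reVec : (Fin n → ℂ) →ₗ[ℝ] EuclideanSpace ℝ (Fin n) where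
  toFun v := WithLp.toLp 2 fun j => (v j).re
  map_add' v w := by ext j; simp
  map_smul' c v := by ext j; simp

/-- The inclusion of `ℝⁿ` into `ℂⁿ`. -/
def ofRealVec : EuclideanSpace ℝ (Fin n) →ₗ[ℝ] (Fin n → ℂ) where
  toFun x j := (x j : ℂ)
  map_add' v w := by ext j; simp
  map_smul' c v := by ext j; simp

theorem realEnd_apply (G : Matrix (Fin n) (Fin n) ℝ) (x : EuclideanSpace ℝ (Fin n)) :
    realEnd G x = WithLp.toLp 2 (G.mulVec x.ofLp) := rfl

theorem complexEnd_apply (G : Matrix (Fin n) (Fin n) ℝ) (v : Fin n → ℂ) :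
    complexEnd G v = (toComplex G).mulVec v := rfl

theorem reVec_complexEnd (G : Matrix (Fin n) (Fin n) ℝ) (v : Fin n → ℂ) :
    reVec (complexEnd G v) = realEnd G (reVec v) := by
  ext j
  simp [reVec, complexEnd_apply, realEnd_apply, toComplex, Matrix.mulVec, dotProduct]

theorem star_complexEnd (G : Matrix (Fin n) (Fin n) ℝ) (v : Fin n → ℂ) :
    star (complexEnd G v) = complexEnd G (star v) := by
  ext j
  simp [complexEnd_apply, toComplex, Matrix.mulVec, dotProduct]

theorem reVec_ofRealVec (x : EuclideanSpace ℝ (Fin n)) : reVec (ofRealVec x) = x := by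
  ext j; simp [reVec, ofRealVec]

theorem reVec_star (v : Fin n → ℂ) : reVec (star v) = reVec v := by
  ext j; simp [reVec]

theorem ofRealVec_reVec (v : Fin n → ℂ) : ofRealVec (reVec v) = (2⁻¹ : ℂ) • (v + star v) := by
  ext j
  simp [reVec, ofRealVec, Complex.add_conj]

theorem star_ofRealVec (x : EuclideanSpace ℝ (Fin n)) : star (ofRealVec x) = ofRealVec x := by
  ext j; simp [ofRealVec]

/-- As `Re(iv) = -Im v`, a complex vector is recovered from two real parts; this carries bounds on
real orbits back to complex ones. -/
theorem ofRealVec_reVec_sub (v : Fin n → ℂ) :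
    ofRealVec (reVec v) - Complex.I • ofRealVec (reVec (Complex.I • v)) = v := by
  ext j
  apply Complex.ext <;> simp [reVec, ofRealVec]

theorem ofRealVec_reVec_of_star_eq {v : Fin n → ℂ} (hv : star v = v) :
    ofRealVec (reVec v) = v := by
  rw [ofRealVec_reVec, hv, ← two_smul ℂ v, smul_smul]; norm_num

variable (G : Matrix (Fin n) (Fin n) ℝ)

theorem star_mem_maxGenEigenspace {q : ℂ} {v : Fin n → ℂ}
    (hv : v ∈ (complexEnd G).maxGenEigenspace q) :
    star v ∈ (complexEnd G).maxGenEigenspace (starRingEnd ℂ q) := by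
  rw [End.mem_maxGenEigenspace] at hv ⊢
  obtain ⟨k, hk⟩ := hv
  refine ⟨k, ?_⟩
  have key : ∀ k : ℕ, ∀ v, ((complexEnd G - starRingEnd ℂ q • (1 : End ℂ (Fin n → ℂ))) ^ k) (star v)
      = star (((complexEnd G - q • (1 : End ℂ (Fin n → ℂ))) ^ k) v) := by
    intro k
    induction k with
    | zero => intro v; simp
    | succ k ih =>
      intro v
      rw [pow_succ, pow_succ, End.mul_apply, End.mul_apply, ← ih]
      congr 1
      simp [star_complexEnd, star_sub, star_smul]
  rw [key, hk, star_zero]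

theorem complexEnd_mem {q : ℂ} {v : Fin n → ℂ} (hv : v ∈ (complexEnd G).maxGenEigenspace q) :
    complexEnd G v ∈ (complexEnd G).maxGenEigenspace q :=
  End.mapsTo_maxGenEigenspace_of_comm (Commute.refl _) q hv

/-- The real parts of the generalized eigenvectors for `q`. -/
noncomputable def reEigenspace (q : ℂ) : Submodule ℝ (EuclideanSpace ℝ (Fin n)) :=
  (((complexEnd G).maxGenEigenspace q).restrictScalars ℝ).map reVec

/-- The sum of the generalized eigenspaces for the eigenvalues other than `q` and its conjugate. -/
noncomputable def otherSpace (q : ℂ) : Submodule ℂ (Fin n → ℂ) :=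
  ⨆ p ∈ ({q, starRingEnd ℂ q} : Set ℂ)ᶜ, (complexEnd G).maxGenEigenspace p

/-- The real parts of the vectors in `otherSpace G q`. -/
noncomputable def reOtherSpace (q : ℂ) : Submodule ℝ (EuclideanSpace ℝ (Fin n)) :=
  ((otherSpace G q).restrictScalars ℝ).map reVec

variable {G}

theorem mem_reEigenspace {q : ℂ} {x : EuclideanSpace ℝ (Fin n)} :
    x ∈ reEigenspace G q ↔ ∃ v ∈ (complexEnd G).maxGenEigenspace q, reVec v = x := Iff.rfl

theorem mem_reOtherSpace {q : ℂ} {x : EuclideanSpace ℝ (Fin n)} :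
    x ∈ reOtherSpace G q ↔ ∃ v ∈ otherSpace G q, reVec v = x := Iff.rfl

theorem reVec_mem_reEigenspace {q : ℂ} {v : Fin n → ℂ}
    (hv : v ∈ (complexEnd G).maxGenEigenspace q) : reVec v ∈ reEigenspace G q :=
  mem_reEigenspace.2 ⟨v, hv, rfl⟩

theorem mem_otherSpace_of_mem {p q : ℂ} (hp : p ∉ ({q, starRingEnd ℂ q} : Set ℂ)) {v : Fin n → ℂ}
    (hv : v ∈ (complexEnd G).maxGenEigenspace p) : v ∈ otherSpace G q :=
  Submodule.mem_iSup_of_mem p (Submodule.mem_iSup_of_mem hp hv)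

/-- An induction principle for `otherSpace G q`. -/
theorem otherSpace_induction {q : ℂ} {P : (Fin n → ℂ) → Prop} {v : Fin n → ℂ}
    (hv : v ∈ otherSpace G q)
    (mem : ∀ p ∉ ({q, starRingEnd ℂ q} : Set ℂ), ∀ v ∈ (complexEnd G).maxGenEigenspace p, P v)
    (zero : P 0) (add : ∀ v w, P v → P w → P (v + w)) : P v := by
  refine Submodule.iSup_induction _ (motive := P) hv (fun p w hw => ?_) zero add
  by_cases hp : p ∈ ({q, starRingEnd ℂ q} : Set ℂ)ᶜ
  · rw [iSup_pos hp] at hw; exact mem p hp w hw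
  · rw [iSup_neg hp, Submodule.mem_bot] at hw; rw [hw]; exact zero

theorem conj_notMem_pair {p q : ℂ} (hp : p ∉ ({q, starRingEnd ℂ q} : Set ℂ)) :
    starRingEnd ℂ p ∉ ({q, starRingEnd ℂ q} : Set ℂ) := by
  rintro (h | h)
  · exact hp (Or.inr (by rw [← h]; simp))
  · exact hp (Or.inl (by simpa using congrArg (starRingEnd ℂ) h))

theorem star_mem_otherSpace {q : ℂ} {v : Fin n → ℂ} (hv : v ∈ otherSpace G q) :
    star v ∈ otherSpace G q := by
  refine otherSpace_induction (P := fun v => star v ∈ otherSpace G q) hv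
    (fun p hp w hw => ?_) (by simp) (fun v w hv hw => ?_)
  · exact mem_otherSpace_of_mem (conj_notMem_pair hp) (star_mem_maxGenEigenspace G hw)
  · rw [star_add]; exact Submodule.add_mem _ hv hw

theorem complexEnd_mem_otherSpace {q : ℂ} {v : Fin n → ℂ} (hv : v ∈ otherSpace G q) :
    complexEnd G v ∈ otherSpace G q := by
  refine otherSpace_induction (P := fun v => complexEnd G v ∈ otherSpace G q) hv
    (fun p hp w hw => mem_otherSpace_of_mem hp (complexEnd_mem G hw)) (by simp)
    (fun v w hv hw => ?_)
  rw [map_add]; exact Submodule.add_mem _ hv hw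

theorem disjoint_otherSpace (q : ℂ) :
    Disjoint ((complexEnd G).maxGenEigenspace q ⊔ (complexEnd G).maxGenEigenspace (starRingEnd ℂ q))
      (otherSpace G q) := by
  have h := (End.independent_maxGenEigenspace (complexEnd G)).disjoint_biSup_biSup
    (s := {q, starRingEnd ℂ q}) (t := ({q, starRingEnd ℂ q} : Set ℂ)ᶜ) disjoint_compl_right
  rwa [iSup_pair] at h

theorem sup_otherSpace (q : ℂ) :
    (complexEnd G).maxGenEigenspace q ⊔ (complexEnd G).maxGenEigenspace (starRingEnd ℂ q) ⊔
      otherSpace G q = ⊤ := by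
  rw [eq_top_iff, ← End.iSup_maxGenEigenspace_eq_top (complexEnd G)]
  refine iSup_le fun p => ?_
  by_cases hp : p ∈ ({q, starRingEnd ℂ q} : Set ℂ)
  · rcases hp with rfl | rfl
    · exact le_sup_left.trans le_sup_left
    · exact le_sup_right.trans le_sup_left
  · have hle : (complexEnd G).maxGenEigenspace p ≤ otherSpace G q :=
      fun v hv => mem_otherSpace_of_mem hp hv
    exact hle.trans le_sup_right

/-- Embedded back into `ℂⁿ`, `Re v` is `(v + v̄)/2`. The conjugation-invariant sums for `{q, q̄}`
and for the remaining eigenvalues are complementary there, and `Re v' = Re v̄'` moves the `q̄` part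
into the `q` part. -/
theorem isCompl_reEigenspace (q : ℂ) : IsCompl (reEigenspace G q) (reOtherSpace G q) := by
  constructor
  · rw [Submodule.disjoint_def]
    intro x hx hx'
    obtain ⟨v, hv, rfl⟩ := mem_reEigenspace.1 hx
    obtain ⟨w, hw, hwv⟩ := mem_reOtherSpace.1 hx'
    have h1 : ofRealVec (reVec v) ∈ otherSpace G q := by
      rw [← hwv, ofRealVec_reVec]
      exact Submodule.smul_mem _ _ (Submodule.add_mem _ hw (star_mem_otherSpace hw))
    have h2 : ofRealVec (reVec v) ∈ (complexEnd G).maxGenEigenspace q ⊔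
        (complexEnd G).maxGenEigenspace (starRingEnd ℂ q) := by
      rw [ofRealVec_reVec]
      exact Submodule.smul_mem _ _ (Submodule.add_mem_sup hv (star_mem_maxGenEigenspace G hv))
    rw [← reVec_ofRealVec (reVec v), Submodule.disjoint_def.1 (disjoint_otherSpace q) _ h2 h1,
      map_zero]
  · rw [codisjoint_iff, eq_top_iff]
    intro x _
    have hx : ofRealVec x ∈ (complexEnd G).maxGenEigenspace q ⊔
        (complexEnd G).maxGenEigenspace (starRingEnd ℂ q) ⊔ otherSpace G q := by
      rw [sup_otherSpace]; trivial
    obtain ⟨a, ha, w, hw, hx⟩ := Submodule.mem_sup.1 hx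
    obtain ⟨v, hv, v', hv', rfl⟩ := Submodule.mem_sup.1 ha
    rw [← reVec_ofRealVec x, ← hx, map_add, map_add]
    refine Submodule.add_mem_sup (Submodule.add_mem _ (reVec_mem_reEigenspace hv) ?_)
      (mem_reOtherSpace.2 ⟨w, hw, rfl⟩)
    rw [← reVec_star]
    exact reVec_mem_reEigenspace (by simpa using star_mem_maxGenEigenspace G hv')

theorem realEnd_mem_reEigenspace {q : ℂ} (x : EuclideanSpace ℝ (Fin n))
    (hx : x ∈ reEigenspace G q) : realEnd G x ∈ reEigenspace G q := by
  obtain ⟨v, hv, rfl⟩ := mem_reEigenspace.1 hx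
  rw [← reVec_complexEnd]
  exact reVec_mem_reEigenspace (complexEnd_mem G hv)

theorem realEnd_mem_reOtherSpace {q : ℂ} (x : EuclideanSpace ℝ (Fin n))
    (hx : x ∈ reOtherSpace G q) : realEnd G x ∈ reOtherSpace G q := by
  obtain ⟨v, hv, rfl⟩ := mem_reOtherSpace.1 hx
  rw [← reVec_complexEnd]
  exact mem_reOtherSpace.2 ⟨_, complexEnd_mem_otherSpace hv, rfl⟩

/-- Generalized eigenvectors for `q`, with real entries if `q` is real. -/
def IsReducedGenEigenvector (G : Matrix (Fin n) (Fin n) ℝ) (q : ℂ) (v : Fin n → ℂ) : Prop :=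
  v ∈ (complexEnd G).maxGenEigenspace q ∧ (starRingEnd ℂ q = q → star v = v)

/-- Reduced representatives are those on which the real part is injective, as
`IsReducedGenEigenvector.eq_zero` shows. -/
theorem exists_reduced {q : ℂ} {x : EuclideanSpace ℝ (Fin n)} (hx : x ∈ reEigenspace G q) :
    ∃ v, IsReducedGenEigenvector G q v ∧ reVec v = x := by
  obtain ⟨v, hv, rfl⟩ := mem_reEigenspace.1 hx
  by_cases hq : starRingEnd ℂ q = q
  · refine ⟨ofRealVec (reVec v), ⟨?_, fun _ => star_ofRealVec _⟩, reVec_ofRealVec _⟩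
    have h1 := star_mem_maxGenEigenspace G hv
    rw [hq] at h1
    rw [ofRealVec_reVec]
    exact Submodule.smul_mem _ _ (Submodule.add_mem _ hv h1)
  · exact ⟨v, ⟨hv, fun h => absurd h hq⟩, rfl⟩

theorem IsReducedGenEigenvector.eq_zero {q : ℂ} {v : Fin n → ℂ} (hv : IsReducedGenEigenvector G q v)
    (h0 : reVec v = 0) : v = 0 := by
  by_cases hq : starRingEnd ℂ q = q
  · rw [← ofRealVec_reVec_of_star_eq (hv.2 hq), h0, map_zero]
  · have h1 := ofRealVec_reVec v
    rw [h0, map_zero, eq_comm, smul_eq_zero_iff_right (by norm_num)] at h1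
    -- For non-real `q` this puts `v` into the generalized eigenspaces of both `q` and `q̄`, which
    -- meet only in zero.
    have h2 : v = -star v := eq_neg_of_add_eq_zero_left h1
    have hd : Disjoint ((complexEnd G).maxGenEigenspace q)
        ((complexEnd G).maxGenEigenspace (starRingEnd ℂ q)) :=
      (End.independent_maxGenEigenspace (complexEnd G)).pairwiseDisjoint (Ne.symm hq)
    refine Submodule.disjoint_def.1 hd v hv.1 ?_
    rw [h2]
    exact Submodule.neg_mem _ (star_mem_maxGenEigenspace G hv.1)

theorem IsReducedGenEigenvector.complexEnd {q : ℂ} {v : Fin n → ℂ}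
    (hv : IsReducedGenEigenvector G q v) : IsReducedGenEigenvector G q (complexEnd G v) :=
  ⟨complexEnd_mem G hv.1, fun hq => by rw [star_complexEnd, hv.2 hq]⟩

theorem IsReducedGenEigenvector.sub {q : ℂ} {v w : Fin n → ℂ}
    (hv : IsReducedGenEigenvector G q v) (hw : IsReducedGenEigenvector G q w) :
    IsReducedGenEigenvector G q (v - w) :=
  ⟨Submodule.sub_mem _ hv.1 hw.1, fun hq => by rw [star_sub, hv.2 hq, hw.2 hq]⟩

theorem IsReducedGenEigenvector.smul {q : ℂ} {v : Fin n → ℂ}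
    (hv : IsReducedGenEigenvector G q v) {c : ℂ} (hc : starRingEnd ℂ q = q → starRingEnd ℂ c = c) :
    IsReducedGenEigenvector G q (c • v) :=
  ⟨Submodule.smul_mem _ _ hv.1, fun hq => by
    rw [star_smul, hv.2 hq, Complex.star_def, hc hq]⟩

theorem eq_zero_of_complexEnd_eq_zero {q : ℂ} (hq : q ≠ 0) {v : Fin n → ℂ}
    (hv : v ∈ (complexEnd G).maxGenEigenspace q) (h0 : complexEnd G v = 0) : v = 0 := by
  have hd : Disjoint ((complexEnd G).maxGenEigenspace q) ((complexEnd G).maxGenEigenspace 0) :=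
    (End.independent_maxGenEigenspace (complexEnd G)).pairwiseDisjoint hq
  refine Submodule.disjoint_def.1 hd v hv ?_
  rw [End.mem_maxGenEigenspace]
  exact ⟨1, by simpa using h0⟩

theorem eq_zero_of_realEnd_eq_zero {q : ℂ} (hq : q ≠ 0) (x : EuclideanSpace ℝ (Fin n))
    (hx : x ∈ reEigenspace G q) (h0 : realEnd G x = 0) : x = 0 := by
  obtain ⟨v, hv, rfl⟩ := exists_reduced hx
  rw [← reVec_complexEnd] at h0
  rw [eq_zero_of_complexEnd_eq_zero hq hv.1 (hv.complexEnd.eq_zero h0), map_zero]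

theorem toComplex_sub_pow_mulVec (q : ℂ) (k : ℕ) (v : Fin n → ℂ) :
    ((toComplex G - q • 1) ^ k).mulVec v =
      ((complexEnd G - q • (1 : End ℂ (Fin n → ℂ))) ^ k) v := by
  have : complexEnd G - q • (1 : End ℂ (Fin n → ℂ)) = Matrix.toLin' (toComplex G - q • 1) := by
    rw [map_sub, map_smul, Matrix.toLin'_one]; rfl
  rw [this, ← Matrix.toLin'_pow, Matrix.toLin'_apply]

theorem rspan_le_reEigenspace {q : ℂ} {v : Fin n → ℂ}
    (hv : v ∈ (complexEnd G).maxGenEigenspace q) : rspan v ≤ reEigenspace G q := by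
  rw [rspan, Submodule.span_le]
  rintro _ (rfl | rfl)
  · refine mem_reEigenspace.2 ⟨(2 : ℂ) • v, Submodule.smul_mem _ _ hv, ?_⟩
    ext j; simp [reVec, two_mul]
  · refine mem_reEigenspace.2 ⟨(2 * Complex.I : ℂ) • v, Submodule.smul_mem _ _ hv, ?_⟩
    ext j; simp [reVec]; ring

theorem reVec_mem_rspan (v : Fin n → ℂ) : reVec v ∈ rspan v := by
  have h : reVec v = (2⁻¹ : ℝ) •
      (WithLp.toLp 2 fun j => (v j + (starRingEnd ℂ) (v j)).re : EuclideanSpace ℝ (Fin n)) := by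
    ext j
    simp only [reVec, LinearMap.coe_mk, AddHom.coe_mk, Complex.add_re, Complex.conj_re,
      PiLp.smul_apply, smul_eq_mul]
    ring
  rw [h]
  exact Submodule.smul_mem _ _ (Submodule.subset_span (Or.inl rfl))

theorem realGenEigenspace_eq (q : ℂ) : realGenEigenspace G q = reEigenspace G q := by
  apply le_antisymm
  · refine iSup₂_le fun v hv => rspan_le_reEigenspace ?_
    obtain ⟨l, -, hl⟩ := hv
    rw [End.mem_maxGenEigenspace]
    exact ⟨l, by rw [← toComplex_sub_pow_mulVec, hl]⟩
  · intro x hx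
    obtain ⟨v, hv, rfl⟩ := mem_reEigenspace.1 hx
    obtain ⟨l, hl⟩ := (End.mem_maxGenEigenspace _ _ _).1 hv
    refine (le_iSup₂_of_le (f := fun v _ => rspan v) v ?_ le_rfl) (reVec_mem_rspan v)
    -- The definition of `realGenEigenspace` asks for a positive exponent, whereas `l` may be zero.
    refine ⟨l + 1, by omega, ?_⟩
    rw [toComplex_sub_pow_mulVec, pow_succ', End.mul_apply, hl, map_zero]

theorem algMult_eq (q : ℂ) : algMult G q = finrank ℂ ((complexEnd G).maxGenEigenspace q) := by
  rw [LinearMap.finrank_maxGenEigenspace_eq, algMult, complexEnd, Matrix.charpoly_toLin']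

/-- The multiplicities are dimensions of nested spaces, so strict inequality means strict inclusion.
-/
theorem isDefective_iff (q : ℂ) :
    IsDefective G q ↔ ¬ (complexEnd G).maxGenEigenspace q ≤ (complexEnd G).eigenspace q := by
  have hle : (complexEnd G).eigenspace q ≤ (complexEnd G).maxGenEigenspace q :=
    End.eigenspace_le_maxGenEigenspace
  rw [IsDefective, algMult_eq, geomMult]
  constructor
  · intro h hle'
    exact h.not_ge (Submodule.finrank_mono hle')
  · intro h
    exact Submodule.finrank_lt_finrank_of_lt (lt_of_le_not_ge hle h)

theorem not_isDefective_conj {q : ℂ} (hq : ¬ IsDefective G q) :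
    ¬ IsDefective G (starRingEnd ℂ q) := by
  rw [isDefective_iff, not_not] at hq ⊢
  intro v hv
  have h1 := hq (by simpa using star_mem_maxGenEigenspace G hv : star v ∈ _)
  rw [End.mem_eigenspace_iff] at h1 ⊢
  have h2 := congrArg star h1
  rwa [star_complexEnd, star_star, star_smul, star_star] at h2

theorem mem_spectrum_iff_exists {q : ℂ} : q ∈ spectrum ℂ (toComplex G) ↔
    ∃ v, v ≠ 0 ∧ complexEnd G v = q • v := by
  rw [← Matrix.spectrum_toLin', ← End.hasEigenvalue_iff_mem_spectrum]
  constructor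
  · intro h
    obtain ⟨v, hv⟩ := h.exists_hasEigenvector
    exact ⟨v, hv.2, hv.apply_eq_smul⟩
  · rintro ⟨v, hv, hq⟩
    exact End.hasEigenvalue_of_hasEigenvector ⟨End.mem_eigenspace_iff.2 hq, hv⟩

theorem mem_spectrum_of_mem_maxGenEigenspace {q : ℂ} {v : Fin n → ℂ} (hv : v ≠ 0)
    (h : v ∈ (complexEnd G).maxGenEigenspace q) : q ∈ spectrum ℂ (toComplex G) := by
  rw [← Matrix.spectrum_toLin', ← End.hasEigenvalue_iff_mem_spectrum]
  obtain ⟨k, hk⟩ := (End.mem_maxGenEigenspace _ _ _).1 h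
  refine End.hasEigenvalue_of_hasGenEigenvalue (k := k) ?_
  refine fun hbot => hv ?_
  have : v ∈ (complexEnd G).genEigenspace q k := by
    rw [End.mem_genEigenspace_nat, LinearMap.mem_ker]; exact hk
  rw [complexEnd, hbot] at this
  simpa using this

end Complexification

/-! ### Growth of powers on generalized eigenspaces. -/

section Growth

variable {Z : Type*} [NormedAddCommGroup Z] [NormedSpace ℂ Z]

theorem pow_apply_of_apply_eq_smul {a : End ℂ Z} {q : ℂ} {v : Z} (hv : a v = q • v) (k : ℕ) :
    (a ^ k) v = q ^ k • v := by
  induction k with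
  | zero => simp
  | succ k ih => rw [pow_succ', End.mul_apply, ih, map_smul, hv, smul_smul, ← pow_succ]

/-- The orbit of a generalized eigenvector for `q` grows more slowly than `r ^ k`, `‖q‖ < r`. -/
theorem exists_norm_pow_apply_le (a : End ℂ Z) {q : ℂ} {r : ℝ} (hr : ‖q‖ < r) (l : ℕ) :
    ∀ v, ((a - q • (1 : End ℂ Z)) ^ l) v = 0 → ∃ C : ℝ, ∀ k : ℕ, ‖(a ^ k) v‖ ≤ C * r ^ k := by
  have hr0 : 0 < r := (norm_nonneg q).trans_lt hr
  induction l with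
  | zero => intro v hv; exact ⟨0, fun k => by simp_all⟩
  | succ l ih =>
    intro v hv
    rw [pow_succ, End.mul_apply] at hv
    obtain ⟨C, hC⟩ := ih _ hv
    have hd : 0 < r - ‖q‖ := sub_pos.2 hr
    -- The inductive step needs `‖q‖ D + C ≤ D r`, that is `C ≤ D (r - ‖q‖)`; the start needs `‖v‖ ≤
    -- D`.
    refine ⟨max ‖v‖ (C / (r - ‖q‖)), fun k => ?_⟩
    induction k with
    | zero => simp
    | succ k ihk =>
      set D := max ‖v‖ (C / (r - ‖q‖))
      have hD : C ≤ D * (r - ‖q‖) := (div_le_iff₀ hd).1 (le_max_right _ _)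
      have h1 : (a ^ (k + 1)) v = q • (a ^ k) v + (a ^ k) ((a - q • (1 : End ℂ Z)) v) := by
        rw [pow_succ, End.mul_apply, LinearMap.sub_apply, map_sub, LinearMap.smul_apply,
          End.one_apply, map_smul]
        abel
      calc ‖(a ^ (k + 1)) v‖ ≤ ‖q‖ * (D * r ^ k) + C * r ^ k := by
            rw [h1]
            refine norm_add_le_of_le ?_ (hC k)
            rw [norm_smul]; gcongr
        _ ≤ ‖q‖ * (D * r ^ k) + D * (r - ‖q‖) * r ^ k := by gcongr
        _ = D * r ^ (k + 1) := by ring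

/-- Binomial expansion of `a = (a - 1) + 1`, cut off by nilpotency. For small `k` the surplus
binomial coefficients vanish. -/
theorem pow_apply_eq_sum_choose (a : End ℂ Z) {p : ℕ} {v : Z}
    (hv : ((a - 1) ^ (p + 1)) v = 0) (k : ℕ) :
    (a ^ k) v = ∑ m ∈ Finset.range (p + 1), (k.choose m : ℂ) • ((a - 1) ^ m) v := by
  have h1 : a ^ k = ∑ m ∈ Finset.range (k + 1), (k.choose m : ℂ) • (a - 1) ^ m := by
    have := (Commute.one_right (a - 1)).add_pow k
    rw [sub_add_cancel] at this
    rw [this]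
    refine Finset.sum_congr rfl fun m _ => ?_
    rw [one_pow, mul_one, Nat.cast_smul_eq_nsmul, nsmul_eq_mul, (Nat.cast_commute _ _).eq]
  have h2 : ∀ m, p + 1 ≤ m → ((a - 1) ^ m) v = 0 := by
    intro m hm
    rw [← Nat.sub_add_cancel hm, pow_add, End.mul_apply, hv, map_zero]
  rw [h1, LinearMap.sum_apply]
  simp only [LinearMap.smul_apply]
  have hA : Finset.range (k + 1) ⊆ Finset.range (k + p + 1) :=
    Finset.range_subset_range.2 (by omega)
  have hB : Finset.range (p + 1) ⊆ Finset.range (k + p + 1) :=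
    Finset.range_subset_range.2 (by omega)
  rw [Finset.sum_subset hA, Finset.sum_subset hB]
  · intro m _ hm
    rw [h2 m (by simpa using hm), smul_zero]
  · intro m _ hm
    rw [Nat.choose_eq_zero_of_lt (by simpa using hm), Nat.cast_zero, zero_smul]

theorem tendsto_choose_div_choose {m p : ℕ} (hmp : m < p) :
    Tendsto (fun k : ℕ => (k.choose m : ℝ) / (k.choose p : ℝ)) atTop (𝓝 0) := by
  refine Asymptotics.IsLittleO.tendsto_div_nhds_zero ?_
  refine (isTheta_choose m).trans_isLittleO (Asymptotics.IsLittleO.trans_isTheta ?_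
    (isTheta_choose p).symm)
  exact (Asymptotics.isLittleO_pow_pow_atTop_of_lt hmp).comp_tendsto tendsto_natCast_atTop_atTop

theorem tendsto_choose_atTop {p : ℕ} (hp : p ≠ 0) :
    Tendsto (fun k : ℕ => (k.choose p : ℝ)) atTop atTop := by
  refine (isEquivalent_choose p).symm.tendsto_atTop ?_
  exact ((tendsto_pow_atTop hp).comp tendsto_natCast_atTop_atTop).atTop_div_const (by positivity)

/-- The leading term of the powers of a unipotent endomorphism. -/
theorem tendsto_choose_inv_smul_pow (a : End ℂ Z) {p : ℕ} {v : Z}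
    (hv : ((a - 1) ^ (p + 1)) v = 0) :
    Tendsto (fun k : ℕ => ((k.choose p : ℝ) : ℂ)⁻¹ • (a ^ k) v) atTop (𝓝 (((a - 1) ^ p) v)) := by
  have h1 : ∀ k : ℕ, p ≤ k → ((k.choose p : ℝ) : ℂ)⁻¹ • (a ^ k) v =
      ∑ m ∈ Finset.range p, (((k.choose m : ℝ) / (k.choose p : ℝ) : ℝ) : ℂ) • ((a - 1) ^ m) v +
        ((a - 1) ^ p) v := by
    intro k hk
    have hne : ((k.choose p : ℝ) : ℂ) ≠ 0 := by
      exact_mod_cast (Nat.choose_pos hk).ne'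
    rw [pow_apply_eq_sum_choose a hv k, Finset.sum_range_succ, smul_add, Finset.smul_sum]
    congr 1
    · refine Finset.sum_congr rfl fun m _ => ?_
      rw [smul_smul]
      congr 1
      push_cast
      rw [div_eq_inv_mul]
    · rw [smul_smul]
      push_cast at hne ⊢
      rw [inv_mul_cancel₀ hne, one_smul]
  have h2 : Tendsto (fun k : ℕ => ∑ m ∈ Finset.range p,
      (((k.choose m : ℝ) / (k.choose p : ℝ) : ℝ) : ℂ) • ((a - 1) ^ m) v + ((a - 1) ^ p) v) atTop
      (𝓝 (((a - 1) ^ p) v)) := by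
    have h3 : Tendsto (fun k : ℕ => ∑ m ∈ Finset.range p,
        (((k.choose m : ℝ) / (k.choose p : ℝ) : ℝ) : ℂ) • ((a - 1) ^ m) v) atTop (𝓝 0) := by
      rw [← Finset.sum_const_zero (s := Finset.range p)]
      refine tendsto_finsetSum _ fun m hm => ?_
      have := (Complex.continuous_ofReal.tendsto 0).comp
        (tendsto_choose_div_choose (Finset.mem_range.1 hm))
      simpa using this.smul_const (((a - 1) ^ m) v)
    simpa using h3.add_const (((a - 1) ^ p) v)
  refine h2.congr' ?_
  filter_upwards [eventually_ge_atTop p] with k hk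
  exact (h1 k hk).symm

theorem exists_pow_succ_apply_eq_zero {a : End ℂ Z} {v : Z} (hv : v ≠ 0)
    (h : ∃ k : ℕ, (a ^ k) v = 0) : ∃ p : ℕ, (a ^ (p + 1)) v = 0 ∧ (a ^ p) v ≠ 0 := by
  classical
  have h0 : Nat.find h ≠ 0 := fun h0 => hv (by simpa [h0] using Nat.find_spec h)
  obtain ⟨p, hp⟩ := Nat.exists_eq_succ_of_ne_zero h0
  refine ⟨p, ?_, Nat.find_min h (by omega)⟩
  rw [← Nat.succ_eq_add_one, ← hp]; exact Nat.find_spec h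

/-- A unipotent bounded orbit is constant. -/
theorem apply_eq_of_bounded_of_unipotent {a : End ℂ Z} {v : Z} (h : ∃ k : ℕ, ((a - 1) ^ k) v = 0)
    {C : ℝ} (hC : ∀ k : ℕ, ‖(a ^ k) v‖ ≤ C) : a v = v := by
  by_cases hv : v = 0
  · simp [hv]
  obtain ⟨p, hp, hp'⟩ := exists_pow_succ_apply_eq_zero hv h
  rcases Nat.eq_zero_or_pos p with rfl | hpos
  · simpa [sub_eq_zero] using hp
  -- For `p > 0`, dividing a bounded orbit by `C(k,p) → ∞` gives limit zero, but the limit is `(a -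
  -- 1)^p v ≠ 0`.
  · refine absurd (tendsto_nhds_unique (tendsto_choose_inv_smul_pow a hp) ?_) hp'
    rw [tendsto_zero_iff_norm_tendsto_zero]
    have h1 := (tendsto_inv_atTop_zero.comp (tendsto_choose_atTop hpos.ne')).mul_const C
    rw [zero_mul] at h1
    refine squeeze_zero (fun _ => norm_nonneg _) (fun k => ?_) h1
    rw [norm_smul, norm_inv, Complex.norm_real, Real.norm_of_nonneg (by positivity)]
    exact mul_le_mul_of_nonneg_left (hC k) (by positivity)

/-- If `b` inverts `a` on an invariant subspace then `b - 1` is nilpotent where `a - 1` is. -/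
theorem sub_one_pow_apply_of_inverse {a b : End ℂ Z} (hab : Commute a b) {W : Submodule ℂ Z}
    (haW : ∀ v ∈ W, a v ∈ W) (hbW : ∀ v ∈ W, b v ∈ W) (hinv : ∀ v ∈ W, b (a v) = v) (k : ℕ) :
    ∀ v ∈ W, ((b - 1) ^ k) v = (-1 : ℂ) ^ k • (b ^ k) (((a - 1) ^ k) v) := by
  induction k with
  | zero => intro v _; simp
  | succ k ih =>
    intro v hv
    -- On `W` the identity `b a = 1` reads `b - 1 = -b (a - 1)`; the claim is its `k`-th power.
    have h1 : (b - 1) v = -(b ((a - 1) v)) := by simp [hinv v hv]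
    have h2 : b ((a - 1) v) ∈ W := by
      refine hbW _ ?_
      simpa using W.sub_mem (haW v hv) hv
    have h3 : ((a - 1) ^ k) (b ((a - 1) v)) = b (((a - 1) ^ (k + 1)) v) := by
      have hc : Commute ((a - 1) ^ k) b := (hab.sub_left (Commute.one_left b)).pow_left k
      rw [← End.mul_apply, hc.eq, End.mul_apply, pow_succ, End.mul_apply]
    rw [pow_succ, End.mul_apply, h1, map_neg, ih _ h2, h3, pow_succ b, End.mul_apply,
      pow_succ (-1 : ℂ), mul_neg_one, neg_smul]

end Growth

/-! ### Uniform bounds from bounds on individual orbits. -/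

section UniformBound

variable {X : Type*} [NormedAddCommGroup X] [NormedSpace ℝ X] [FiniteDimensional ℝ X]

/-- Banach–Steinhaus for the maps composed with a projection onto `W`. It permits estimates one
generalized eigenvector at a time. -/
theorem exists_uniform_bound (A : ℕ → End ℝ X) (W : Submodule ℝ X)
    (h : ∀ x ∈ W, ∃ C : ℝ, ∀ k, ‖A k x‖ ≤ C) :
    ∃ C : ℝ, 0 ≤ C ∧ ∀ x ∈ W, ∀ k, ‖A k x‖ ≤ C * ‖x‖ := by
  obtain ⟨W', hW'⟩ := W.exists_isCompl
  have : CompleteSpace X := FiniteDimensional.complete ℝ X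
  obtain ⟨C, hC⟩ := banach_steinhaus
    (g := fun k => LinearMap.toContinuousLinearMap (A k ∘ₗ W.projection W' hW'))
    (fun x => h _ (Submodule.projection_apply_mem hW' x))
  refine ⟨C, (norm_nonneg _).trans (hC 0), fun x hx k => ?_⟩
  have h1 := ContinuousLinearMap.le_of_opNorm_le _ (hC k) x
  simpa [Submodule.projection_apply_of_mem_left hW' hx] using h1

end UniformBound

/-! ### Simultaneous return times of two rotations. -/

section Recurrence

/-- The times along which both `u ^ k` and `w ^ k` return to `1`. -/
noncomputable def returnTimes (u w : Circle) : Filter ℕ :=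
  atTop ⊓ comap (fun k : ℕ => (u, w) ^ k) (𝓝 1)

/-- In the compact group `Circle × Circle`, the powers of any element accumulate at the identity. -/
instance returnTimes_neBot (u w : Circle) : (returnTimes u w).NeBot := by
  rw [returnTimes, neBot_inf_comap_iff_map, inf_comm]
  exact mapClusterPt_one_atTop_pow (u, w)

theorem returnTimes_le_atTop (u w : Circle) : returnTimes u w ≤ atTop := inf_le_left

theorem tendsto_returnTimes (u w : Circle) :
    Tendsto (fun k : ℕ => (u : ℂ) ^ k) (returnTimes u w) (𝓝 1) ∧
      Tendsto (fun k : ℕ => (w : ℂ) ^ k) (returnTimes u w) (𝓝 1) := by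
  have h : Tendsto (fun k : ℕ => (u, w) ^ k) (returnTimes u w) (𝓝 1) :=
    tendsto_comap.mono_left inf_le_right
  have h1 : Tendsto (fun z : Circle × Circle => (z.1 : ℂ)) (𝓝 1) (𝓝 1) := by
    have hc : Continuous (fun z : Circle × Circle => (z.1 : ℂ)) := by fun_prop
    simpa using hc.tendsto 1
  have h2 : Tendsto (fun z : Circle × Circle => (z.2 : ℂ)) (𝓝 1) (𝓝 1) := by
    have hc : Continuous (fun z : Circle × Circle => (z.2 : ℂ)) := by fun_prop
    simpa using hc.tendsto 1
  exact ⟨by simpa [Function.comp_def] using h1.comp h, by simpa [Function.comp_def] using h2.comp h⟩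

end Recurrence

/-! ### Leading terms of forward and backward orbits in a generalized eigenspace. -/

section Leading

variable {n : ℕ} {G : Matrix (Fin n) (Fin n) ℝ}

theorem reVec_aeval (b : Polynomial ℝ) (v : Fin n → ℂ) :
    reVec (Polynomial.aeval (complexEnd G) b v) = Polynomial.aeval (realEnd G) b (reVec v) := by
  have hpow : ∀ k : ℕ, reVec ((complexEnd G ^ k) v) = (realEnd G ^ k) (reVec v) := by
    intro k
    induction k with
    | zero => simp
    | succ k ih => rw [pow_succ', pow_succ', End.mul_apply, End.mul_apply, reVec_complexEnd, ih]
  induction b using Polynomial.induction_on' with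
  | add p q hp hq => simp only [map_add, LinearMap.add_apply, hp, hq]
  | monomial k c =>
    simp only [Polynomial.aeval_monomial, End.mul_apply, Module.algebraMap_end_apply, map_smul,
      hpow]

/-- A real endomorphism which commutes with `G` and inverts it on a generalized eigenspace. -/
theorem exists_inverse (G : Matrix (Fin n) (Fin n) ℝ) {q : ℂ} (hq : q ≠ 0) :
    ∃ (g' : End ℝ (EuclideanSpace ℝ (Fin n))) (T' : End ℂ (Fin n → ℂ)),
      (∀ v, reVec (T' v) = g' (reVec v)) ∧ Commute (complexEnd G) T' ∧
      ∀ v ∈ (complexEnd G).maxGenEigenspace q, T' (complexEnd G v) = v := by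
  -- `Q₀ = (X - q)(X - q̄)` is real, is coprime to `X` as `q ≠ 0`, and its `n`-th power kills the
  -- generalized eigenspace. A Bézout relation `b X + d Q₀^n = 1` makes `b(G)` the inverse of `G`
  -- there.
  open Polynomial in
  let Q₀ : ℝ[X] := X ^ 2 - C (2 * q.re) * X + C (Complex.normSq q)
  have hcop : IsCoprime (X : ℝ[X]) (Q₀ ^ n) := by
    refine IsCoprime.pow_right ?_
    rw [irreducible_X.coprime_iff_not_dvd, X_dvd_iff]
    simp [Q₀, hq]
  obtain ⟨b, d, hbd⟩ := hcop
  refine ⟨aeval (realEnd G) b, aeval (complexEnd G) b, reVec_aeval b, ?_, ?_⟩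
  · have := (Commute.all X b).map (aeval (R := ℝ) (complexEnd G))
    simpa using this
  intro v hv
  have hQ : aeval (complexEnd G) Q₀ =
      (complexEnd G - starRingEnd ℂ q • (1 : End ℂ (Fin n → ℂ))) *
        (complexEnd G - q • (1 : End ℂ (Fin n → ℂ))) := by
    have h1 : ((q.re : ℂ) + (q.re : ℂ)) = starRingEnd ℂ q + q := by
      rw [add_comm (starRingEnd ℂ q), Complex.add_conj]; push_cast; ring
    have h2 : ((Complex.normSq q : ℝ) : ℂ) = starRingEnd ℂ q * q := by
      rw [mul_comm, Complex.mul_conj]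
    ext1 i
    ext1
    simp only [Q₀, map_add, map_sub, map_mul, map_pow, aeval_X, aeval_C, LinearMap.add_apply,
      LinearMap.sub_apply, End.mul_apply, Module.algebraMap_end_apply, LinearMap.comp_apply,
      LinearMap.smul_apply, End.one_apply, map_smul, pow_two (complexEnd G), smul_sub, smul_smul]
    have h3 : ∀ w : Fin n → ℂ, (2 * q.re) • w = (starRingEnd ℂ q + q) • w := by
      intro w
      rw [← h1, ← Complex.coe_smul]; push_cast; ring_nf
    rw [h3, add_smul, ← Complex.coe_smul, h2, mul_comm q]
    abel
  have hc : Commute (complexEnd G - starRingEnd ℂ q • (1 : End ℂ (Fin n → ℂ)))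
      (complexEnd G - q • (1 : End ℂ (Fin n → ℂ))) := by
    refine Commute.sub_left ?_ ?_
    · exact (Commute.refl _).sub_right ((Commute.one_right _).smul_right q)
    · exact ((Commute.one_left _).smul_left _)
  have h0 : aeval (complexEnd G) (Q₀ ^ n) v = 0 := by
    rw [map_pow, hQ, hc.mul_pow, End.mul_apply]
    rw [End.maxGenEigenspace_eq_genEigenspace_finrank, finrank_fin_fun,
      End.mem_genEigenspace_nat, LinearMap.mem_ker] at hv
    rw [hv, map_zero]
  rw [map_pow] at h0
  have h1 := congrArg (fun P => aeval (complexEnd G) P v) hbd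
  simpa [h0] using h1

/-- `G` divided by the modulus of `q`. -/
noncomputable def scaledEnd (G : Matrix (Fin n) (Fin n) ℝ) (q : ℂ) :
    End ℝ (EuclideanSpace ℝ (Fin n)) := ‖q‖⁻¹ • realEnd G

/-- `G` divided by `q`. -/
noncomputable def unipotentEnd (G : Matrix (Fin n) (Fin n) ℝ) (q : ℂ) :
    End ℂ (Fin n → ℂ) := q⁻¹ • complexEnd G

theorem exists_circle (q : ℂ) : ∃ u : Circle, (u : ℂ) * ‖q‖ = q :=
  ⟨Circle.exp q.arg, by rw [Circle.coe_exp, mul_comm, Complex.norm_mul_exp_arg_mul_I]⟩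

theorem pow_reVec_eq {B : End ℝ (EuclideanSpace ℝ (Fin n))} {A : End ℂ (Fin n → ℂ)} {c : ℂ}
    (h : ∀ v, B (reVec v) = reVec (c • A v)) (k : ℕ) (v : Fin n → ℂ) :
    (B ^ k) (reVec v) = reVec (c ^ k • (A ^ k) v) := by
  induction k with
  | zero => simp
  | succ k ih =>
    rw [pow_succ', End.mul_apply, ih, h, map_smul A, smul_smul, ← pow_succ', pow_succ' A,
      End.mul_apply]

theorem reVec_real_smul (r : ℝ) (v : Fin n → ℂ) : reVec ((r : ℂ) • v) = r • reVec v := by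
  rw [Complex.coe_smul, map_smul]

/-- Since `G / |q| = u (G / q)`, the orbit separates into a rotation and a unipotent part. -/
theorem scaledEnd_pow_reVec {q : ℂ} (hq : q ≠ 0) {u : Circle} (hu : (u : ℂ) * ‖q‖ = q) (k : ℕ)
    (v : Fin n → ℂ) :
    (scaledEnd G q ^ k) (reVec v) = reVec ((u : ℂ) ^ k • (unipotentEnd G q ^ k) v) := by
  refine pow_reVec_eq (fun v => ?_) k v
  have h0 : (‖q‖ : ℂ) ≠ 0 := by simpa using hq
  have h1 : (u : ℂ) * q⁻¹ = ((‖q‖⁻¹ : ℝ) : ℂ) := by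
    conv_lhs => rw [← hu]
    have := u.coe_ne_zero
    push_cast
    field_simp
  rw [unipotentEnd, LinearMap.smul_apply, smul_smul, h1, reVec_real_smul, reVec_complexEnd]
  rfl

theorem mem_maxGenEigenspace_iff_unipotentEnd {q : ℂ} (hq : q ≠ 0) (v : Fin n → ℂ) :
    v ∈ (complexEnd G).maxGenEigenspace q ↔ ∃ k : ℕ, ((unipotentEnd G q - 1) ^ k) v = 0 := by
  have h1 : unipotentEnd G q - 1 = q⁻¹ • (complexEnd G - q • (1 : End ℂ (Fin n → ℂ))) := by
    rw [unipotentEnd, smul_sub, smul_smul, inv_mul_cancel₀ hq, one_smul]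
  rw [End.mem_maxGenEigenspace]
  refine exists_congr fun k => ?_
  rw [h1, smul_pow, LinearMap.smul_apply, smul_eq_zero_iff_right (pow_ne_zero _ (inv_ne_zero hq))]

theorem IsReducedGenEigenvector.unipotentEnd {q : ℂ} {v : Fin n → ℂ}
    (hv : IsReducedGenEigenvector G q v) : IsReducedGenEigenvector G q (unipotentEnd G q v) :=
  hv.complexEnd.smul fun h => by rw [map_inv₀, h]

theorem IsReducedGenEigenvector.unipotentEnd_sub_one_pow {q : ℂ} {v : Fin n → ℂ}
    (hv : IsReducedGenEigenvector G q v) (k : ℕ) :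
    IsReducedGenEigenvector G q (((STC.unipotentEnd G q - 1) ^ k) v) := by
  induction k with
  | zero => simpa using hv
  | succ k ih =>
    rw [pow_succ', End.mul_apply]
    exact ih.unipotentEnd.sub ih

/-- The inverse of `scaledEnd G q` on the real parts of generalized eigenvectors, together with
the inverse of `unipotentEnd G q`. -/
theorem exists_scaled_inverse (G : Matrix (Fin n) (Fin n) ℝ) {q : ℂ} (hq : q ≠ 0) {u : Circle}
    (hu : (u : ℂ) * ‖q‖ = q) :
    ∃ (h' : End ℝ (EuclideanSpace ℝ (Fin n))) (b : End ℂ (Fin n → ℂ)),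
      Commute (unipotentEnd G q) b ∧ (∀ v ∈ (complexEnd G).maxGenEigenspace q,
        b v ∈ (complexEnd G).maxGenEigenspace q) ∧
      (∀ v ∈ (complexEnd G).maxGenEigenspace q, b (unipotentEnd G q v) = v) ∧
      ∀ (k : ℕ) v, (h' ^ k) (reVec v) = reVec ((u : ℂ)⁻¹ ^ k • (b ^ k) v) := by
  obtain ⟨g', T', hre, hcomm, hinv⟩ := exists_inverse G hq
  refine ⟨‖q‖ • g', q • T', ?_, fun v hv => ?_, fun v hv => ?_, fun k v => ?_⟩
  · exact (hcomm.smul_left _).smul_right _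
  · exact Submodule.smul_mem _ _ (End.mapsTo_maxGenEigenspace_of_comm hcomm q hv)
  · rw [unipotentEnd, LinearMap.smul_apply, LinearMap.smul_apply, map_smul, smul_smul,
      mul_inv_cancel₀ hq, one_smul, hinv v hv]
  · refine pow_reVec_eq (fun v => ?_) k v
    have h1 : (u : ℂ)⁻¹ * q = ((‖q‖ : ℝ) : ℂ) := by
      conv_lhs => rw [← hu]
      rw [inv_mul_cancel_left₀ u.coe_ne_zero]
    rw [LinearMap.smul_apply, LinearMap.smul_apply, smul_smul, h1, reVec_real_smul, hre]

theorem unipotentEnd_mem {q : ℂ} {v : Fin n → ℂ} (hv : v ∈ (complexEnd G).maxGenEigenspace q) :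
    unipotentEnd G q v ∈ (complexEnd G).maxGenEigenspace q :=
  Submodule.smul_mem _ _ (complexEnd_mem G hv)

theorem continuous_reVec : Continuous (reVec : (Fin n → ℂ) →ₗ[ℝ] EuclideanSpace ℝ (Fin n)) :=
  LinearMap.continuous_of_finiteDimensional _

theorem exists_norm_reVec_le (n : ℕ) : ∃ C : ℝ, 0 < C ∧ ∀ v : Fin n → ℂ, ‖reVec v‖ ≤ C * ‖v‖ := by
  obtain ⟨C, hC, h⟩ :=
    (⟨reVec, continuous_reVec⟩ : (Fin n → ℂ) →L[ℝ] EuclideanSpace ℝ (Fin n)).bound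
  exact ⟨C, hC, h⟩

theorem boundedOrbit_of_apply_eq {q : ℂ} (hq : q ≠ 0) {v : Fin n → ℂ}
    (hv : unipotentEnd G q v = v) : BoundedOrbit (scaledEnd G q) (reVec v) := by
  obtain ⟨u, hu⟩ := exists_circle q
  obtain ⟨C, hC, hb⟩ := exists_norm_reVec_le n
  refine ⟨C * ‖v‖, fun k => ?_⟩
  rw [scaledEnd_pow_reVec hq hu, pow_apply_of_apply_eq_smul (q := 1) (by simpa using hv)]
  refine (hb _).trans (le_of_eq ?_)
  rw [one_pow, one_smul, norm_smul, norm_pow, Circle.norm_coe, one_pow, one_mul]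

theorem unipotentEnd_apply_eq_iff {q : ℂ} (hq : q ≠ 0) {v : Fin n → ℂ} :
    unipotentEnd G q v = v ↔ complexEnd G v = q • v := by
  rw [unipotentEnd, LinearMap.smul_apply, inv_smul_eq_iff₀ hq]

/-- Let `p` be the last exponent with `z = (S - 1)^p v ≠ 0`, where `S = G / q`. Then `S^k v ~ C(k,p)
z`, and the rotation disappears along `l`. For the inverse `b`, `(b - 1)^p v = (-1)^p z`, whence the
sign. The rate `C(k,p)` is unbounded unless `p = 0`, when `v = z` is fixed by `S`. -/
theorem exists_hasLeadingTerm {q : ℂ} (hq : q ≠ 0) {u : Circle} (hu : (u : ℂ) * ‖q‖ = q)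
    {l : Filter ℕ} (hl : l ≤ atTop) (hul : Tendsto (fun k : ℕ => (u : ℂ) ^ k) l (𝓝 1))
    (x : EuclideanSpace ℝ (Fin n)) (hx : x ∈ reEigenspace G q) (hx0 : x ≠ 0) :
    ∃ y c, HasLeadingTerm (scaledEnd G q) (reEigenspace G q) l x y c := by
  obtain ⟨v, hv, rfl⟩ := exists_reduced hx
  have hv0 : v ≠ 0 := by rintro rfl; simp at hx0
  obtain ⟨p, hp, hp'⟩ := exists_pow_succ_apply_eq_zero hv0
    ((mem_maxGenEigenspace_iff_unipotentEnd hq v).1 hv.1)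
  obtain ⟨h', b, hcomm, hbV, hinv, hpow'⟩ := exists_scaled_inverse G hq hu
  set S := unipotentEnd G q with hS
  set z := ((S - 1) ^ p) v with hz
  have hzred : IsReducedGenEigenvector G q z := hv.unipotentEnd_sub_one_pow p
  have hSz : S z = z := by
    rw [pow_succ', End.mul_apply, ← hz, LinearMap.sub_apply, End.one_apply, sub_eq_zero] at hp
    exact hp
  have hbz : b z = z := by conv_lhs => rw [← hSz, hinv z hzred.1]
  have hbpow : ∀ k v, v ∈ (complexEnd G).maxGenEigenspace q →
      (b ^ k) v ∈ (complexEnd G).maxGenEigenspace q := fun k v hv =>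
    show _ ∈ (((complexEnd G).maxGenEigenspace q : Submodule ℂ (Fin n → ℂ)) : Set (Fin n → ℂ)) from
      pow_apply_mem hbV k hv
  have hul' : Tendsto (fun k : ℕ => (u : ℂ)⁻¹ ^ k) l (𝓝 1) := by
    simpa using hul.inv₀ one_ne_zero
  have hlim : ∀ (c : ℂ) (A : End ℂ (Fin n → ℂ)) (v : Fin n → ℂ),
      Tendsto (fun k : ℕ => c ^ k) l (𝓝 1) → ((A - 1) ^ (p + 1)) v = 0 →
      Tendsto (fun k : ℕ => ((k.choose p : ℕ) : ℝ)⁻¹ • reVec (c ^ k • (A ^ k) v)) l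
        (𝓝 (reVec (((A - 1) ^ p) v))) := by
    intro c A v hc hA
    have h1 := hc.smul ((tendsto_choose_inv_smul_pow A hA).mono_left hl)
    rw [one_smul] at h1
    refine ((continuous_reVec.tendsto _).comp h1).congr fun k => ?_
    rw [← reVec_real_smul, Function.comp_apply, smul_comm, Complex.ofReal_inv]
  refine ⟨reVec z, fun k => (k.choose p : ℝ), reVec_mem_reEigenspace hzred.1,
    fun h0 => hp' (hzred.eq_zero h0), boundedOrbit_of_apply_eq hq hSz, ?_, ?_, ?_, ?_, ?_⟩
  · have h1 := (continuous_reVec.tendsto _).comp (hul.smul_const z)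
    rw [one_smul] at h1
    refine h1.congr fun k => ?_
    rw [scaledEnd_pow_reVec hq hu, pow_apply_of_apply_eq_smul (q := 1) (by simpa using hSz)]
    simp
  · filter_upwards [hl (eventually_ge_atTop p)] with k hk
    exact_mod_cast Nat.choose_pos hk
  · exact (hlim u S v hul hp).congr fun k => by rw [scaledEnd_pow_reVec hq hu]
  · refine ⟨fun k => (h' ^ k) (reVec v), fun k => ⟨?_, ?_⟩, ?_⟩
    · beta_reduce
      rw [hpow']
      exact reVec_mem_reEigenspace (Submodule.smul_mem _ _ (hbpow k v hv.1))
    · beta_reduce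
      rw [hpow', scaledEnd_pow_reVec hq hu, ← hS, map_smul (S ^ k), smul_smul, ← mul_pow,
        mul_inv_cancel₀ u.coe_ne_zero, one_pow, one_smul, ← End.mul_apply, ← hcomm.mul_pow]
      congr 1
      have hab : (S * b) v = (1 : ℂ) • v := by
        rw [hcomm.eq, End.mul_apply, hinv v hv.1, one_smul]
      rw [pow_apply_of_apply_eq_smul hab, one_pow, one_smul]
    · have hsub := sub_one_pow_apply_of_inverse hcomm (fun v hv => unipotentEnd_mem hv) hbV hinv
      have h1 := hlim (u : ℂ)⁻¹ b v hul' (by rw [hsub _ v hv.1, hp, map_zero, smul_zero])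
      rw [hsub p v hv.1, ← hz, pow_apply_of_apply_eq_smul (q := 1) (by simpa using hbz), one_pow,
        one_smul] at h1
      have h2 : Tendsto (fun k : ℕ => ((k.choose p : ℕ) : ℝ)⁻¹ • (h' ^ k) (reVec v)) l
          (𝓝 (reVec ((-1 : ℂ) ^ p • z))) := h1.congr fun k => by rw [hpow']
      rcases neg_one_pow_eq_or ℂ p with hs | hs
      · left; rwa [hs, one_smul] at h2
      · right; rwa [hs, neg_one_smul, map_neg] at h2
  · rcases Nat.eq_zero_or_pos p with rfl | hpos
    · left
      rw [pow_zero, End.one_apply] at hz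
      rw [← hz]
      exact boundedOrbit_of_apply_eq hq hSz
    · right
      exact (tendsto_choose_atTop hpos.ne').mono_left hl

end Leading

/-! ### Spectral conditions as bounds on orbits, and conversely. -/

section Estimates

variable {n : ℕ} {G : Matrix (Fin n) (Fin n) ℝ}

theorem scaledEnd_pow_reVec' (q : ℂ) (k : ℕ) (v : Fin n → ℂ) :
    (scaledEnd G q ^ k) (reVec v) = (‖q‖⁻¹ ^ k) • reVec ((complexEnd G ^ k) v) := by
  rw [pow_reVec_eq (A := complexEnd G) (c := ((‖q‖⁻¹ : ℝ) : ℂ)), ← Complex.ofReal_pow,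
    reVec_real_smul]
  intro v
  rw [reVec_real_smul, reVec_complexEnd]
  rfl

theorem scaledEnd_mem {q : ℂ} {W : Submodule ℝ (EuclideanSpace ℝ (Fin n))}
    (hW : ∀ x ∈ W, realEnd G x ∈ W) (x : EuclideanSpace ℝ (Fin n)) (hx : x ∈ W) :
    scaledEnd G q x ∈ W := W.smul_mem _ (hW x hx)

theorem exists_orbit_bound (a : End ℂ (Fin n → ℂ)) {q : ℂ} {r : ℝ} (hr : ‖q‖ < r)
    {v : Fin n → ℂ} (hv : v ∈ a.maxGenEigenspace q) :
    ∃ C : ℝ, ∀ k : ℕ, ‖(a ^ k) v‖ ≤ C * r ^ k := by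
  obtain ⟨l, hl⟩ := (End.mem_maxGenEigenspace _ _ _).1 hv
  exact exists_norm_pow_apply_le a hr l v hl

theorem norm_scaledEnd_pow_reVec_le {q : ℂ} (hq : q ≠ 0) {θ C : ℝ} {v : Fin n → ℂ}
    (hv : ∀ k : ℕ, ‖(complexEnd G ^ k) v‖ ≤ C * (θ * ‖q‖) ^ k) :
    ∃ D : ℝ, ∀ k : ℕ, ‖(scaledEnd G q ^ k) (reVec v)‖ ≤ D * θ ^ k := by
  obtain ⟨B, hB, hb⟩ := exists_norm_reVec_le n
  have hq' : 0 < ‖q‖ := norm_pos_iff.2 hq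
  refine ⟨B * C, fun k => ?_⟩
  rw [scaledEnd_pow_reVec', norm_smul, Real.norm_of_nonneg (by positivity)]
  calc ‖q‖⁻¹ ^ k * ‖reVec ((complexEnd G ^ k) v)‖ ≤ ‖q‖⁻¹ ^ k * (B * (C * (θ * ‖q‖) ^ k)) := by
        gcongr
        exact (hb _).trans (by gcongr; exact hv k)
    _ = B * C * θ ^ k := by
        rw [mul_pow, inv_pow]
        field_simp

/-- The spectrum is finite, so the largest ratio `‖p‖ / ‖q‖` is below one; its midpoint with one
serves. -/
theorem exists_dominating_rate {q : ℂ} (hq : q ≠ 0)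
    (hlt : ∀ p ∈ spectrum ℂ (toComplex G) \ {q, starRingEnd ℂ q}, ‖p‖ < ‖q‖) :
    ∃ θ : ℝ, 0 < θ ∧ θ < 1 ∧
      ∀ p ∈ spectrum ℂ (toComplex G) \ {q, starRingEnd ℂ q}, ‖p‖ < θ * ‖q‖ := by
  have hq' : 0 < ‖q‖ := norm_pos_iff.2 hq
  have hfin : (spectrum ℂ (toComplex G) \ {q, starRingEnd ℂ q}).Finite := by
    refine Set.Finite.sdiff ?_
    rw [← Matrix.spectrum_toLin']
    exact End.finite_spectrum _
  rcases (spectrum ℂ (toComplex G) \ {q, starRingEnd ℂ q}).eq_empty_or_nonempty with he | hne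
  · exact ⟨1 / 2, by norm_num, by norm_num, by simp [he]⟩
  · obtain ⟨p₀, hp₀, hmax⟩ := Set.exists_max_image _ (fun p : ℂ => ‖p‖) hfin hne
    have h0 := hlt p₀ hp₀
    refine ⟨(‖p₀‖ / ‖q‖ + 1) / 2, by positivity, ?_, fun p hp => (hmax p hp).trans_lt ?_⟩
    · have := (div_lt_one hq').2 h0
      linarith
    · have : (‖p₀‖ / ‖q‖ + 1) / 2 * ‖q‖ = (‖p₀‖ + ‖q‖) / 2 := by field_simp
      rw [this]; linarith

/-- The components in the other eigenspaces are dominated if the other eigenvalues have smaller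
modulus. -/
theorem exists_domination {q : ℂ} (hq : q ≠ 0)
    (hlt : ∀ p ∈ spectrum ℂ (toComplex G) \ {q, starRingEnd ℂ q}, ‖p‖ < ‖q‖) :
    ∃ C η : ℝ, 0 ≤ η ∧ η < 1 ∧ ∀ k, ∀ e ∈ reEigenspace G q, ∀ f ∈ reOtherSpace G q,
      ‖(scaledEnd G q ^ k) f‖ * ‖e‖ ≤ C * η ^ k * (‖(scaledEnd G q ^ k) e‖ * ‖f‖) := by
  obtain ⟨θ, hθ0, hθ1, hθ⟩ := exists_dominating_rate hq hlt
  -- On `F` the powers decay like `θ^k`. On `E` the inverse is a rotation times a unipotent map, so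
  -- its powers are `O(s^k)` for any `s > 1`; `s < θ⁻¹` makes `η = θ s < 1`.
  obtain ⟨s, hs1, hs2⟩ := exists_between ((one_lt_inv₀ hθ0).2 hθ1)
  have hs0 : 0 < s := one_pos.trans hs1
  obtain ⟨u, hu⟩ := exists_circle q
  obtain ⟨h', b, hcomm, hbV, hinv, hpow'⟩ := exists_scaled_inverse G hq hu
  obtain ⟨B, hB, hb⟩ := exists_norm_reVec_le n
  obtain ⟨C, hC0, hC⟩ := exists_uniform_bound (fun k => (θ⁻¹ ^ k) • scaledEnd G q ^ k)
    (reOtherSpace G q) (by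
      intro x hx
      obtain ⟨v, hv, rfl⟩ := mem_reOtherSpace.1 hx
      have key : ∃ D : ℝ, ∀ k : ℕ, ‖(complexEnd G ^ k) v‖ ≤ D * (θ * ‖q‖) ^ k := by
        refine otherSpace_induction (P := fun v => ∃ D : ℝ, ∀ k : ℕ,
          ‖(complexEnd G ^ k) v‖ ≤ D * (θ * ‖q‖) ^ k) hv (fun p hp w hw => ?_)
          ⟨0, fun k => by simp⟩ ?_
        · by_cases hw0 : w = 0
          · exact ⟨0, fun k => by simp [hw0]⟩
          · exact exists_orbit_bound _ (hθ p ⟨mem_spectrum_of_mem_maxGenEigenspace hw0 hw, hp⟩) hw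
        · rintro v w ⟨D, hD⟩ ⟨D', hD'⟩
          refine ⟨D + D', fun k => ?_⟩
          rw [map_add, add_mul]
          exact norm_add_le_of_le (hD k) (hD' k)
      obtain ⟨D, hD⟩ := key
      obtain ⟨D', hD'⟩ := norm_scaledEnd_pow_reVec_le hq hD
      refine ⟨D', fun k => ?_⟩
      rw [LinearMap.smul_apply, norm_smul, Real.norm_of_nonneg (by positivity), inv_pow,
        ← div_eq_inv_mul, div_le_iff₀ (by positivity)]
      exact hD' k)
  obtain ⟨D, hD0, hD⟩ := exists_uniform_bound (fun k => (s⁻¹ ^ k) • h' ^ k)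
    (reEigenspace G q) (by
      intro x hx
      obtain ⟨v, hv, rfl⟩ := mem_reEigenspace.1 hx
      obtain ⟨l, hl⟩ := (mem_maxGenEigenspace_iff_unipotentEnd hq v).1 hv
      have hl' : ((b - (1 : ℂ) • (1 : End ℂ (Fin n → ℂ))) ^ l) v = 0 := by
        rw [one_smul, sub_one_pow_apply_of_inverse hcomm (fun v hv => unipotentEnd_mem hv) hbV hinv
          l v hv, hl, map_zero, smul_zero]
      obtain ⟨D, hD⟩ := exists_norm_pow_apply_le b (r := s) (by simpa using hs1) l v hl'
      refine ⟨B * D, fun k => ?_⟩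
      rw [LinearMap.smul_apply, norm_smul, Real.norm_of_nonneg (by positivity), inv_pow,
        ← div_eq_inv_mul, div_le_iff₀ (by positivity), hpow', mul_assoc]
      refine (hb _).trans ?_
      rw [norm_smul, norm_pow, norm_inv, Circle.norm_coe, inv_one, one_pow, one_mul]
      exact mul_le_mul_of_nonneg_left (hD k) hB.le)
  have hinv' : ∀ (k : ℕ), ∀ e ∈ reEigenspace G q, (h' ^ k) ((scaledEnd G q ^ k) e) = e := by
    intro k e he
    obtain ⟨v, hv, rfl⟩ := mem_reEigenspace.1 he
    rw [scaledEnd_pow_reVec hq hu, hpow', map_smul (b ^ k), smul_smul, ← mul_pow,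
      inv_mul_cancel₀ u.coe_ne_zero, one_pow, one_smul, ← End.mul_apply, ← hcomm.symm.mul_pow]
    congr 1
    have hab : (b * unipotentEnd G q) v = (1 : ℂ) • v := by
      rw [End.mul_apply, hinv v hv, one_smul]
    rw [pow_apply_of_apply_eq_smul hab, one_pow, one_smul]
  refine ⟨C * D, θ * s, by positivity, ?_, fun k e he f hf => ?_⟩
  · have := mul_lt_mul_of_pos_left hs2 hθ0
    rwa [mul_inv_cancel₀ hθ0.ne'] at this
  · have h1 := hC f hf k
    have h2 := hD _ (show _ ∈ (reEigenspace G q : Set (EuclideanSpace ℝ (Fin n))) from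
      pow_apply_mem (scaledEnd_mem (q := q) realEnd_mem_reEigenspace) k he) k
    rw [LinearMap.smul_apply, norm_smul, Real.norm_of_nonneg (by positivity), inv_pow,
        ← div_eq_inv_mul, div_le_iff₀ (by positivity)] at h1 h2
    rw [hinv' k e he] at h2
    calc ‖(scaledEnd G q ^ k) f‖ * ‖e‖
        ≤ (C * ‖f‖ * θ ^ k) * (D * ‖(scaledEnd G q ^ k) e‖ * s ^ k) := by gcongr
      _ = _ := by rw [mul_pow]; ring

/-- The scaled powers are bounded if all dominant eigenvalues are non-defective. -/
theorem exists_power_bound {q : ℂ} (hq : q ≠ 0)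
    (hle : ∀ p ∈ spectrum ℂ (toComplex G), ‖p‖ ≤ ‖q‖)
    (hnd : ∀ p ∈ spectrum ℂ (toComplex G), ‖p‖ = ‖q‖ → ¬ IsDefective G p) :
    ∃ C : ℝ, ∀ k x, ‖(scaledEnd G q ^ k) x‖ ≤ C * ‖x‖ := by
  have hq' : 0 < ‖q‖ := norm_pos_iff.2 hq
  obtain ⟨C, -, hC⟩ := exists_uniform_bound (fun k => scaledEnd G q ^ k) ⊤ (by
    intro x _
    have hx : ofRealVec x ∈ ⨆ p, (complexEnd G).maxGenEigenspace p := by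
      rw [End.iSup_maxGenEigenspace_eq_top]; trivial
    have key : ∃ D : ℝ, ∀ k : ℕ, ‖(complexEnd G ^ k) (ofRealVec x)‖ ≤ D * (1 * ‖q‖) ^ k := by
      refine Submodule.iSup_induction _ (motive := fun v => ∃ D : ℝ, ∀ k : ℕ,
          ‖(complexEnd G ^ k) v‖ ≤ D * (1 * ‖q‖) ^ k) hx (fun p w hw => ?_)
          ⟨0, fun k => by simp⟩ ?_
      · by_cases hw0 : w = 0
        · exact ⟨0, fun k => by simp [hw0]⟩
        have hp := mem_spectrum_of_mem_maxGenEigenspace hw0 hw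
        rcases (hle p hp).lt_or_eq with hlt | heq
        · exact exists_orbit_bound _ (by rwa [one_mul]) hw
        · have h1 := hnd p hp heq
          rw [isDefective_iff, not_not] at h1
          refine ⟨‖w‖, fun k => ?_⟩
          rw [pow_apply_of_apply_eq_smul (End.mem_eigenspace_iff.1 (h1 hw)), norm_smul, norm_pow,
            heq, one_mul, mul_comm]
      · rintro v w ⟨D, hD⟩ ⟨D', hD'⟩
        refine ⟨D + D', fun k => ?_⟩
        rw [map_add, add_mul]
        exact norm_add_le_of_le (hD k) (hD' k)
    obtain ⟨D, hD⟩ := key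
    obtain ⟨D', hD'⟩ := norm_scaledEnd_pow_reVec_le hq hD
    refine ⟨D', fun k => ?_⟩
    have := hD' k
    rwa [one_pow, mul_one, reVec_ofRealVec] at this)
  exact ⟨C, fun k x => hC x trivial k⟩

/-- For non-defective `q`, `G / q` is the identity on the generalized eigenspace, so the scaled
inverse acts by rotations and has bounded powers. The bound `C` may be zero, hence `C + 1`. -/
theorem exists_lower_bound {q : ℂ} (hq : q ≠ 0) (hnd : ¬ IsDefective G q) :
    ∃ c : ℝ, 0 < c ∧ ∀ k, ∀ x ∈ reEigenspace G q, c * ‖x‖ ≤ ‖(scaledEnd G q ^ k) x‖ := by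
  rw [isDefective_iff, not_not] at hnd
  obtain ⟨u, hu⟩ := exists_circle q
  obtain ⟨h', b, hcomm, hbV, hinv, hpow'⟩ := exists_scaled_inverse G hq hu
  obtain ⟨B, hB, hb⟩ := exists_norm_reVec_le n
  have hS : ∀ v ∈ (complexEnd G).maxGenEigenspace q, unipotentEnd G q v = v := fun v hv =>
    (unipotentEnd_apply_eq_iff hq).2 (End.mem_eigenspace_iff.1 (hnd hv))
  have hbv : ∀ v ∈ (complexEnd G).maxGenEigenspace q, b v = (1 : ℂ) • v := fun v hv => by
    conv_lhs => rw [← hS v hv]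
    rw [hinv v hv, one_smul]
  obtain ⟨C, hC0, hC⟩ := exists_uniform_bound (fun k => h' ^ k) (reEigenspace G q) (by
    intro x hx
    obtain ⟨v, hv, rfl⟩ := mem_reEigenspace.1 hx
    refine ⟨B * ‖v‖, fun k => ?_⟩
    rw [hpow', pow_apply_of_apply_eq_smul (hbv v hv), one_pow, one_smul]
    refine (hb _).trans_eq ?_
    rw [norm_smul, norm_pow, norm_inv, Circle.norm_coe, inv_one, one_pow, one_mul])
  refine ⟨(C + 1)⁻¹, by positivity, fun k x hx => ?_⟩
  have h1 := hC _ (show _ ∈ (reEigenspace G q : Set (EuclideanSpace ℝ (Fin n))) from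
      pow_apply_mem (scaledEnd_mem (q := q) realEnd_mem_reEigenspace) k hx) k
  have h2 : (h' ^ k) ((scaledEnd G q ^ k) x) = x := by
    obtain ⟨v, hv, rfl⟩ := mem_reEigenspace.1 hx
    rw [scaledEnd_pow_reVec hq hu, hpow', map_smul (b ^ k),
      pow_apply_of_apply_eq_smul (a := unipotentEnd G q) (q := 1) (v := v)
        (by rw [hS v hv, one_smul]), one_pow, one_smul,
      pow_apply_of_apply_eq_smul (hbv v hv), one_pow, one_smul, smul_smul, ← mul_pow,
      inv_mul_cancel₀ u.coe_ne_zero, one_pow, one_smul]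
  rw [h2] at h1
  rw [inv_mul_le_iff₀ (by positivity)]
  nlinarith [norm_nonneg ((scaledEnd G q ^ k) x)]

/-- If the orbits of `v` and `√-1 v` have bounded real parts, then the orbit of `v` is bounded. -/
theorem exists_bound_of_boundedOrbit {q : ℂ} {v : Fin n → ℂ}
    (h1 : BoundedOrbit (scaledEnd G q) (reVec v))
    (h2 : BoundedOrbit (scaledEnd G q) (reVec (Complex.I • v))) :
    ∃ C : ℝ, ∀ k : ℕ, ‖q‖⁻¹ ^ k * ‖(complexEnd G ^ k) v‖ ≤ C := by
  obtain ⟨C, hC⟩ := h1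
  obtain ⟨D, hD⟩ := h2
  have hcont : Continuous (ofRealVec : EuclideanSpace ℝ (Fin n) →ₗ[ℝ] (Fin n → ℂ)) :=
    LinearMap.continuous_of_finiteDimensional _
  obtain ⟨B, hB, hb⟩ :=
    (⟨ofRealVec, hcont⟩ : EuclideanSpace ℝ (Fin n) →L[ℝ] (Fin n → ℂ)).bound
  have hb' : ∀ x : EuclideanSpace ℝ (Fin n), ‖ofRealVec x‖ ≤ B * ‖x‖ := hb
  refine ⟨B * C + B * D, fun k => ?_⟩
  have h3 : ‖q‖⁻¹ ^ k * ‖(complexEnd G ^ k) v‖ = ‖(((‖q‖⁻¹ ^ k : ℝ) : ℂ)) • (complexEnd G ^ k) v‖ := by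
    rw [norm_smul, Complex.norm_real, Real.norm_of_nonneg (by positivity)]
  have h4 : reVec ((((‖q‖⁻¹ ^ k : ℝ) : ℂ)) • (complexEnd G ^ k) v) =
      (scaledEnd G q ^ k) (reVec v) := by
    rw [scaledEnd_pow_reVec', reVec_real_smul]
  have h5 : reVec (Complex.I • (((‖q‖⁻¹ ^ k : ℝ) : ℂ)) • (complexEnd G ^ k) v) =
      (scaledEnd G q ^ k) (reVec (Complex.I • v)) := by
    rw [scaledEnd_pow_reVec', smul_comm, reVec_real_smul, map_smul (complexEnd G ^ k)]
  rw [h3, ← ofRealVec_reVec_sub ((((‖q‖⁻¹ ^ k : ℝ) : ℂ)) • (complexEnd G ^ k) v), h4, h5]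
  refine (norm_sub_le _ _).trans (add_le_add ((hb' _).trans ?_) ?_)
  · exact mul_le_mul_of_nonneg_left (hC k) hB.le
  · rw [norm_smul, Complex.norm_I, one_mul]
    exact (hb' _).trans (mul_le_mul_of_nonneg_left (hD k) hB.le)

theorem apply_eq_smul_of_bounded {q p : ℂ} (hp : p ≠ 0) (hpq : ‖p‖ = ‖q‖) {v : Fin n → ℂ}
    (hv : v ∈ (complexEnd G).maxGenEigenspace p) {C : ℝ}
    (hC : ∀ k : ℕ, ‖q‖⁻¹ ^ k * ‖(complexEnd G ^ k) v‖ ≤ C) : complexEnd G v = p • v := by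
  rw [← unipotentEnd_apply_eq_iff hp]
  refine apply_eq_of_bounded_of_unipotent ((mem_maxGenEigenspace_iff_unipotentEnd hp v).1 hv)
    (C := C) fun k => ?_
  have h1 : unipotentEnd G p ^ k = (p⁻¹ ^ k) • complexEnd G ^ k := smul_pow _ _ _
  rw [h1, LinearMap.smul_apply, norm_smul, norm_pow, norm_inv, hpq]
  exact hC k

theorem norm_le_of_bounded {q p : ℂ} (hq : q ≠ 0) {v : Fin n → ℂ} (hv0 : v ≠ 0)
    (hv : complexEnd G v = p • v) {C : ℝ}
    (hC : ∀ k : ℕ, ‖q‖⁻¹ ^ k * ‖(complexEnd G ^ k) v‖ ≤ C) : ‖p‖ ≤ ‖q‖ := by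
  by_contra! hlt
  have hq' : 0 < ‖q‖ := norm_pos_iff.2 hq
  have hv' : 0 < ‖v‖ := norm_pos_iff.2 hv0
  obtain ⟨k, hk⟩ := pow_unbounded_of_one_lt (C / ‖v‖) ((one_lt_div hq').2 hlt)
  refine (hC k).not_gt ?_
  rw [pow_apply_of_apply_eq_smul hv, norm_smul, norm_pow, ← mul_assoc, ← mul_pow,
    ← div_eq_inv_mul, ← div_lt_iff₀ hv']
  exact hk

theorem exists_unbounded_of_isDefective {q : ℂ} (hq : q ≠ 0) (hd : IsDefective G q) :
    ∃ t ∈ reEigenspace G q, ¬ BoundedOrbit (scaledEnd G q) t := by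
  by_contra! hcon
  rw [isDefective_iff] at hd
  refine hd fun v hv => End.mem_eigenspace_iff.2 ?_
  obtain ⟨C, hC⟩ := exists_bound_of_boundedOrbit (hcon _ (reVec_mem_reEigenspace hv))
    (hcon _ (reVec_mem_reEigenspace (Submodule.smul_mem _ Complex.I hv)))
  exact apply_eq_smul_of_bounded hq rfl hv hC

theorem spectrum_of_boundedOrbit {q : ℂ} (hq : q ≠ 0)
    (hb : ∀ w ∈ reOtherSpace G q, BoundedOrbit (scaledEnd G q) w) {p : ℂ}
    (hp : p ∈ spectrum ℂ (toComplex G) \ {q, starRingEnd ℂ q}) :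
    ‖p‖ ≤ ‖q‖ ∧ (‖p‖ = ‖q‖ → ¬ IsDefective G p) := by
  have key : ∀ v ∈ (complexEnd G).maxGenEigenspace p,
      ∃ C : ℝ, ∀ k : ℕ, ‖q‖⁻¹ ^ k * ‖(complexEnd G ^ k) v‖ ≤ C := fun v hv =>
    exists_bound_of_boundedOrbit
      (hb _ (mem_reOtherSpace.2 ⟨v, mem_otherSpace_of_mem hp.2 hv, rfl⟩))
      (hb _ (mem_reOtherSpace.2
        ⟨_, Submodule.smul_mem _ Complex.I (mem_otherSpace_of_mem hp.2 hv), rfl⟩))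
  constructor
  · obtain ⟨v, hv0, hv⟩ := mem_spectrum_iff_exists.1 hp.1
    obtain ⟨C, hC⟩ := key v (End.eigenspace_le_maxGenEigenspace (End.mem_eigenspace_iff.2 hv))
    exact norm_le_of_bounded hq hv0 hv hC
  · intro heq
    have hp0 : p ≠ 0 := by
      rw [← norm_ne_zero_iff, heq]; exact norm_ne_zero_iff.2 hq
    rw [isDefective_iff, not_not]
    intro v hv
    obtain ⟨C, hC⟩ := key v hv
    exact End.mem_eigenspace_iff.2 (apply_eq_smul_of_bounded hp0 heq hv hC)

/-- Real parts of eigenvectors for eigenvalues of maximal modulus are recurrent. -/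
theorem tendsto_scaledEnd_pow {q p : ℂ} (hq : q ≠ 0) {w : Circle} (hw : (w : ℂ) * ‖q‖ = p)
    {l : Filter ℕ} (hl : Tendsto (fun k : ℕ => (w : ℂ) ^ k) l (𝓝 1)) {v : Fin n → ℂ}
    (hv : complexEnd G v = p • v) :
    Tendsto (fun k => (scaledEnd G q ^ k) (reVec v)) l (𝓝 (reVec v)) := by
  have h0 : (‖q‖ : ℂ) ≠ 0 := by simpa using hq
  have h1 := (continuous_reVec.tendsto _).comp (hl.smul_const v)
  rw [one_smul] at h1
  refine h1.congr fun k => ?_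
  rw [scaledEnd_pow_reVec', pow_apply_of_apply_eq_smul hv, ← reVec_real_smul, smul_smul,
    Function.comp_apply, ← hw]
  congr 2
  push_cast
  rw [mul_pow, inv_pow]
  field_simp

theorem exists_recurrent_of_norm_eq {q p : ℂ} (hq : q ≠ 0) (hpq : ‖p‖ = ‖q‖)
    (hp : p ∈ spectrum ℂ (toComplex G) \ {q, starRingEnd ℂ q}) :
    ∃ w : Circle, ∃ x ∈ reOtherSpace G q, x ≠ 0 ∧ ∀ l : Filter ℕ,
      Tendsto (fun k : ℕ => (w : ℂ) ^ k) l (𝓝 1) →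
      Tendsto (fun k => (scaledEnd G q ^ k) x) l (𝓝 x) := by
  obtain ⟨v, hv0, hv⟩ := mem_spectrum_iff_exists.1 hp.1
  obtain ⟨w, hw⟩ := exists_circle p
  rw [hpq] at hw
  have hvO := mem_otherSpace_of_mem hp.2
    (End.eigenspace_le_maxGenEigenspace (End.mem_eigenspace_iff.2 hv))
  -- The eigenvector may be purely imaginary; then `i v` is used instead.
  by_cases h0 : reVec v = 0
  · refine ⟨w, reVec (Complex.I • v),
      mem_reOtherSpace.2 ⟨_, Submodule.smul_mem _ _ hvO, rfl⟩, fun h1 => hv0 ?_, fun l hl => ?_⟩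
    · rw [← ofRealVec_reVec_sub v, h0, h1, map_zero, smul_zero, sub_zero]
    · exact tendsto_scaledEnd_pow hq hw hl (by rw [map_smul, hv, smul_comm])
  · exact ⟨w, reVec v, mem_reOtherSpace.2 ⟨v, hvO, rfl⟩, h0, fun l hl =>
      tendsto_scaledEnd_pow hq hw hl hv⟩

/-- If the real generalized eigenspace is at most a line, the eigenvalue is real and simple. -/
theorem real_and_simple_of_finrank_le_one {q : ℂ} (hq : q ∈ spectrum ℂ (toComplex G))
    (hE : finrank ℝ (reEigenspace G q) ≤ 1) :
    starRingEnd ℂ q = q ∧ algMult G q = 1 := by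
  obtain ⟨v₀, hv₀, hqv₀⟩ := mem_spectrum_iff_exists.1 hq
  have hV₀ : v₀ ∈ (complexEnd G).maxGenEigenspace q :=
    End.eigenspace_le_maxGenEigenspace (End.mem_eigenspace_iff.2 hqv₀)
  obtain ⟨x, hx⟩ := finrank_le_one_iff.1 hE
  -- Both real parts in `v = Re v - i Re(iv)` are multiples of `x`, so the complex space is spanned
  -- by one real vector. A real vector also lies in the space for `q̄`, which forces `q = q̄`.
  have hspan : ∀ v ∈ (complexEnd G).maxGenEigenspace q, ∃ c : ℂ, v = c • ofRealVec (x : _) := by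
    intro v hv
    obtain ⟨a, ha⟩ := hx ⟨_, reVec_mem_reEigenspace hv⟩
    obtain ⟨b, hb⟩ := hx ⟨_, reVec_mem_reEigenspace (Submodule.smul_mem _ Complex.I hv)⟩
    refine ⟨a - Complex.I * b, ?_⟩
    have ha' := congrArg Subtype.val ha
    have hb' := congrArg Subtype.val hb
    simp only [Submodule.coe_smul] at ha' hb'
    conv_lhs => rw [← ofRealVec_reVec_sub v, ← ha', ← hb']
    rw [map_smul, map_smul, sub_smul, mul_smul, Complex.coe_smul, Complex.coe_smul]
  obtain ⟨c, hc⟩ := hspan v₀ hV₀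
  have hc0 : c ≠ 0 := by rintro rfl; simp [hv₀] at hc
  have hxV : ofRealVec (x : EuclideanSpace ℝ (Fin n)) ∈ (complexEnd G).maxGenEigenspace q := by
    have := Submodule.smul_mem _ c⁻¹ hV₀
    rwa [hc, smul_smul, inv_mul_cancel₀ hc0, one_smul] at this
  have hx0 : ofRealVec (x : EuclideanSpace ℝ (Fin n)) ≠ 0 := by
    intro h0; rw [h0, smul_zero] at hc; exact hv₀ hc
  constructor
  · by_contra hne
    have hd : Disjoint ((complexEnd G).maxGenEigenspace q)
        ((complexEnd G).maxGenEigenspace (starRingEnd ℂ q)) :=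
      (End.independent_maxGenEigenspace (complexEnd G)).pairwiseDisjoint (Ne.symm hne)
    refine hx0 (Submodule.disjoint_def.1 hd _ hxV ?_)
    rw [← star_ofRealVec]
    exact star_mem_maxGenEigenspace G hxV
  · rw [algMult_eq, finrank_eq_one_iff']
    refine ⟨⟨_, hxV⟩, fun h0 => hx0 (congrArg Subtype.val h0), fun w => ?_⟩
    obtain ⟨c, hc⟩ := hspan w w.2
    exact ⟨c, Subtype.ext hc.symm⟩

theorem exists_smul_of_algMult_eq_one {q : ℂ} (hq : starRingEnd ℂ q = q) (h1 : algMult G q = 1)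
    (m : EuclideanSpace ℝ (Fin n)) (hm : m ∈ reEigenspace G q) (hm0 : m ≠ 0)
    (e : EuclideanSpace ℝ (Fin n)) (he : e ∈ reEigenspace G q) : ∃ c : ℝ, e = c • m := by
  have hι : ∀ x ∈ reEigenspace G q, ofRealVec x ∈ (complexEnd G).maxGenEigenspace q := by
    intro x hx
    obtain ⟨v, hv, rfl⟩ := exists_reduced hx
    rw [ofRealVec_reVec_of_star_eq (hv.2 hq)]
    exact hv.1
  rw [algMult_eq] at h1
  have hne : (⟨_, hι m hm⟩ : (complexEnd G).maxGenEigenspace q) ≠ 0 := by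
    intro h0
    refine hm0 ?_
    have h2 : ofRealVec m = 0 := congrArg Subtype.val h0
    rw [← reVec_ofRealVec m, h2, map_zero]
  obtain ⟨c, hc⟩ := exists_smul_eq_of_finrank_eq_one h1 hne ⟨_, hι e he⟩
  have hc' : c • ofRealVec m = ofRealVec e := congrArg Subtype.val hc
  refine ⟨c.re, ?_⟩
  rw [← reVec_ofRealVec e, ← hc']
  ext j
  simp [reVec, ofRealVec]

end Estimates

/-! ### From orbits of the normalized nonlinear map to orbits of directions. -/

section Projectivization

theorem mem_cthickening_iff_infDist_le {X : Type*} [PseudoMetricSpace X] {T : Set X}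
    (hT : T.Nonempty) {δ : ℝ} (hδ : 0 ≤ δ) {x : X} : x ∈ cthickening δ T ↔ infDist x T ≤ δ := by
  rw [mem_cthickening_iff, infDist,
    ENNReal.le_ofReal_iff_toReal_le (infEDist_ne_top hT) hδ]

theorem normalize_iterate {X : Type*} [NormedAddCommGroup X] [NormedSpace ℝ X]
    {f : X → X} {h : End ℝ X} {U : Set X} (hf : ∀ x ∈ U, f x = NormedSpace.normalize (h x))
    (z : X) (k : ℕ) (hU : ∀ j < k, f^[j] z ∈ U) :
    NormedSpace.normalize (f^[k] z) = NormedSpace.normalize ((h ^ k) z) := by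
  have hnorm : ∀ x y : X, NormedSpace.normalize x = NormedSpace.normalize y →
      NormedSpace.normalize (h x) = NormedSpace.normalize (h y) := by
    have key : ∀ x : X, NormedSpace.normalize (h x) =
        NormedSpace.normalize (h (NormedSpace.normalize x)) := by
      intro x
      by_cases hx : x = 0
      · simp [hx]
      · conv_lhs => rw [← norm_smul_normalize x, map_smul]
        rw [normalize_smul_of_pos (norm_pos_iff.2 hx)]
    intro x y hxy
    rw [key x, key y, hxy]
  induction k with
  | zero => simp
  | succ k ih =>
    rw [Function.iterate_succ_apply', hf _ (hU k (by omega)), normalize_normalize, pow_succ',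
      End.mul_apply]
    exact hnorm _ _ (ih fun j hj => hU j (by omega))

/-- The zeroth iterate is `z` itself, not its direction, hence the alternative in `hk`. -/
theorem iterate_eq_normalize {X : Type*} [NormedAddCommGroup X] [NormedSpace ℝ X]
    {f : X → X} {h : End ℝ X} {U : Set X} (hf : ∀ x ∈ U, f x = NormedSpace.normalize (h x))
    (z : X) (k : ℕ) (hk : k ≠ 0 ∨ ‖z‖ = 1) (hU : ∀ j < k, f^[j] z ∈ U) :
    f^[k] z = NormedSpace.normalize ((h ^ k) z) := by
  rw [← normalize_iterate hf z k hU]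
  cases k with
  | zero =>
    simpa using (normalize_eq_self_of_norm_eq_one (hk.resolve_left (by simp))).symm
  | succ k =>
    rw [Function.iterate_succ_apply', hf _ (hU k (by omega)), normalize_normalize]

variable {n : ℕ} {f : EuclideanSpace ℝ (Fin n) → EuclideanSpace ℝ (Fin n)}
  {h : End ℝ (EuclideanSpace ℝ (Fin n))} {E F : Submodule ℝ (EuclideanSpace ℝ (Fin n))}
  {M U : Set (EuclideanSpace ℝ (Fin n))}

/-- Neighbourhoods of the set of directions also contain vectors that are not unit; normalizing them
at most doubles the distance. -/
theorem angDist_le_two_mul_infDist (hM : InvariantCone h E F M) (z : EuclideanSpace ℝ (Fin n)) :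
    angDist M z ≤ 2 * infDist z (M ∩ sphere 0 1) := by
  obtain ⟨m, hm, hd⟩ := hM.isClosed_inter.exists_infDist_eq_dist hM.nonempty z
  have hm1 : ‖m‖ = 1 := by simpa using hm.2
  rw [hd, dist_eq_norm]
  simpa [hm1] using hM.angDist_le z hm.1 (by rintro rfl; simp at hm1)

theorem exists_cthickening_subset (hM : InvariantCone h E F M) (hU : IsOpen U)
    (hMU : M ∩ sphere 0 1 ⊆ U) : ∃ δ, 0 < δ ∧ cthickening δ (M ∩ sphere 0 1) ⊆ U :=
  ((isCompact_sphere 0 1).of_isClosed_subset hM.isClosed_inter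
    Set.inter_subset_right).exists_cthickening_subset_open hU hMU

theorem angDist_pow_normalize (h : End ℝ (EuclideanSpace ℝ (Fin n)))
    (M : Set (EuclideanSpace ℝ (Fin n))) {x : EuclideanSpace ℝ (Fin n)} (hx : x ≠ 0) (k : ℕ) :
    angDist M ((h ^ k) (NormedSpace.normalize x)) = angDist M ((h ^ k) x) := by
  have hx' : 0 < ‖x‖⁻¹ := inv_pos.2 (norm_pos_iff.2 hx)
  rw [NormedSpace.normalize, map_smul, angDist_smul M hx']

/-- The linear formula holds only while the orbit stays in `U`, so `ε` is replaced by `min ε ε₀`.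
Conversely, strong induction works: closeness before time `k` gives the formula at time `k`, and
linear stability gives closeness there. -/
theorem isStableSet_iff (hM : InvariantCone h E F M) (hU : IsOpen U)
    (hMU : M ∩ sphere 0 1 ⊆ U) (hf : ∀ x ∈ U, f x = NormedSpace.normalize (h x)) :
    IsStableSet f (M ∩ sphere 0 1) ↔ LinStable h M := by
  obtain ⟨ε₀, hε₀, hsub⟩ := exists_cthickening_subset hM hU hMU
  have hne := hM.nonempty
  constructor
  · intro hs ε hε
    obtain ⟨δ, hδ, hst⟩ := hs (min ε ε₀) (by positivity)
    refine ⟨min δ (1 / 2), by positivity, fun x hx k => ?_⟩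
    have hx0 : x ≠ 0 := hM.ne_zero_of_angDist_lt
      (lt_of_le_of_lt (hx.trans (min_le_right _ _)) (by norm_num))
    have hz := hst (NormedSpace.normalize x) ((mem_cthickening_iff_infDist_le hne hδ.le).2
      (hx.trans (min_le_left _ _)))
    have hit := iterate_eq_normalize hf (NormedSpace.normalize x) k (Or.inr (norm_normalize hx0))
      fun j _ => hsub (cthickening_mono (min_le_right _ _) _ (hz j))
    have h1 := cthickening_mono (min_le_left _ _) _ (hz k)
    rw [mem_cthickening_iff_infDist_le hne hε.le, hit] at h1
    rw [← angDist_pow_normalize h M hx0]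
    exact h1
  · intro hs ε hε
    obtain ⟨δ, hδ, hst⟩ := hs (min ε ε₀) (by positivity)
    refine ⟨min (δ / 2) (min ε ε₀), by positivity, fun z hz k => ?_⟩
    refine cthickening_mono (min_le_left ε ε₀) _ ?_
    have hz' : angDist M z ≤ δ := by
      have h1 := cthickening_mono (min_le_left _ _) _ hz
      rw [mem_cthickening_iff_infDist_le hne (by positivity)] at h1
      linarith [angDist_le_two_mul_infDist hM z]
    induction k using Nat.strong_induction_on with
    | _ k ih =>
      rcases Nat.eq_zero_or_pos k with rfl | hk
      · exact cthickening_mono (min_le_right _ _) _ hz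
      · rw [iterate_eq_normalize hf z k (Or.inl hk.ne')
          fun j hj => hsub (cthickening_mono (min_le_right _ _) _ (ih j hj)),
          mem_cthickening_iff_infDist_le hne (by positivity)]
        exact hst z hz' k

theorem isAsympStableSet_iff (hM : InvariantCone h E F M) (hU : IsOpen U)
    (hMU : M ∩ sphere 0 1 ⊆ U) (hf : ∀ x ∈ U, f x = NormedSpace.normalize (h x)) :
    IsAsympStableSet f (M ∩ sphere 0 1) ↔ LinStable h M ∧ LinAttractive h M := by
  rw [IsAsympStableSet, ← isStableSet_iff hM hU hMU hf]
  refine and_congr_right fun hs => ?_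
  obtain ⟨ε₀, hε₀, hsub⟩ := exists_cthickening_subset hM hU hMU
  have hne := hM.nonempty
  obtain ⟨δ₀, hδ₀, hst⟩ := hs ε₀ hε₀
  constructor
  · rintro ⟨δ, hδ, hatt⟩
    refine ⟨min (min δ δ₀) (1 / 2), by positivity, fun x hx => ?_⟩
    have hx0 : x ≠ 0 := hM.ne_zero_of_angDist_lt
      (lt_of_le_of_lt (hx.trans (min_le_right _ _)) (by norm_num))
    have hz : NormedSpace.normalize x ∈ cthickening (min δ δ₀) (M ∩ sphere 0 1) :=
      (mem_cthickening_iff_infDist_le hne (by positivity)).2 (hx.trans (min_le_left _ _))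
    refine (hatt _ (cthickening_mono (min_le_left _ _) _ hz)).congr fun k => ?_
    rw [iterate_eq_normalize hf (NormedSpace.normalize x) k (Or.inr (norm_normalize hx0))
      fun j _ => hsub (hst _ (cthickening_mono (min_le_right _ _) _ hz) j)]
    exact angDist_pow_normalize h M hx0 k
  · rintro ⟨δ, hδ, hatt⟩
    refine ⟨min (δ / 2) δ₀, by positivity, fun z hz => ?_⟩
    have hz' : angDist M z ≤ δ := by
      have h1 := cthickening_mono (min_le_left _ _) _ hz
      rw [mem_cthickening_iff_infDist_le hne (by positivity)] at h1
      linarith [angDist_le_two_mul_infDist hM z]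
    refine (hatt z hz').congr' ?_
    filter_upwards [eventually_ne_atTop 0] with k hk
    rw [iterate_eq_normalize hf z k (Or.inl hk)
      fun j _ => hsub (hst _ (cthickening_mono (min_le_right _ _) _ hz) j)]
    rfl

theorem isUnstableSet_iff (f : EuclideanSpace ℝ (Fin n) → EuclideanSpace ℝ (Fin n))
    (T : Set (EuclideanSpace ℝ (Fin n))) : IsUnstableSet f T ↔ ¬ IsStableSet f T := by
  simp only [IsUnstableSet, IsStableSet]
  push Not
  rfl

end Projectivization

/-! ### Spectral criteria for stability and attractivity of the cone. -/

section LinearCriteria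

variable {n : ℕ} {G : Matrix (Fin n) (Fin n) ℝ} {q : ℂ} {M : Set (EuclideanSpace ℝ (Fin n))}

/-- Every nonzero vector of the generalized eigenspace has a leading term along the times at which
the phase of `q` and `w` return to `1`. -/
theorem exists_returnTimes (hq : q ≠ 0) (w : Circle) :
    ∃ l : Filter ℕ, l.NeBot ∧ l ≤ atTop ∧ Tendsto (fun k : ℕ => (w : ℂ) ^ k) l (𝓝 1) ∧
      (∀ t ∈ reEigenspace G q, t ≠ 0 →
        ∃ z c, HasLeadingTerm (scaledEnd G q) (reEigenspace G q) l t z c) ∧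
      (¬ IsDefective G q → ∀ t ∈ reEigenspace G q,
        Tendsto (fun k => (scaledEnd G q ^ k) t) l (𝓝 t)) := by
  obtain ⟨u, hu⟩ := exists_circle q
  refine ⟨returnTimes u w, inferInstance, returnTimes_le_atTop u w, (tendsto_returnTimes u w).2,
    exists_hasLeadingTerm hq hu (returnTimes_le_atTop u w) (tendsto_returnTimes u w).1, ?_⟩
  intro hnd t ht
  rw [isDefective_iff, not_not] at hnd
  obtain ⟨v, hv, rfl⟩ := mem_reEigenspace.1 ht
  exact tendsto_scaledEnd_pow hq hu (tendsto_returnTimes u w).1 (End.mem_eigenspace_iff.1 (hnd hv))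

namespace InvariantCone

theorem spectrum_of_linStable
    (hM : InvariantCone (scaledEnd G q) (reEigenspace G q) (reOtherSpace G q) M) (hq : q ≠ 0)
    (hs : LinStable (scaledEnd G q) M) :
    ∀ p ∈ spectrum ℂ (toComplex G) \ {q, starRingEnd ℂ q},
      ‖p‖ ≤ ‖q‖ ∧ (‖p‖ = ‖q‖ → ¬ IsDefective G p) := by
  obtain ⟨l, hl, -, -, hL, -⟩ := exists_returnTimes (G := G) hq 1
  obtain ⟨x, hx, hx0⟩ := hM.exists_ne
  obtain ⟨y, c, hy⟩ := hL x (hM.subset hx) hx0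
  exact fun p hp => spectrum_of_boundedOrbit hq (fun w hw =>
    hM.boundedOrbit_of_linStable hs (hM.mem_of_hasLeadingTerm hx hy) hy.ne_zero hy.bounded hw) hp

theorem subset_of_linStable_of_isDefective
    (hM : InvariantCone (scaledEnd G q) (reEigenspace G q) (reOtherSpace G q) M) (hq : q ≠ 0)
    (hd : IsDefective G q) (hs : LinStable (scaledEnd G q) M) :
    (reEigenspace G q : Set (EuclideanSpace ℝ (Fin n))) ⊆ M := by
  obtain ⟨l, hl, -, -, hL, -⟩ := exists_returnTimes (G := G) hq 1
  obtain ⟨t, ht, htu⟩ := exists_unbounded_of_isDefective hq hd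
  exact hM.subset_of_linStable_of_unbounded hs hL ht htu

theorem norm_lt_of_linStable_of_isDefective
    (hM : InvariantCone (scaledEnd G q) (reEigenspace G q) (reOtherSpace G q) M) (hq : q ≠ 0)
    (hd : IsDefective G q) (hs : LinStable (scaledEnd G q) M) :
    ∀ p ∈ spectrum ℂ (toComplex G) \ {q, starRingEnd ℂ q}, ‖p‖ < ‖q‖ := by
  intro p hp
  refine lt_of_le_of_ne (hM.spectrum_of_linStable hq hs p hp).1 fun heq => ?_
  obtain ⟨w, x, hx, hx0, hrec⟩ := exists_recurrent_of_norm_eq hq heq hp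
  -- The return times suit both the phase of `q`, for the leading terms in `E`, and that of `p`, for
  -- the recurrence of `x`.
  obtain ⟨l, hl, -, hw, hL, -⟩ := exists_returnTimes (G := G) hq w
  obtain ⟨t, ht, htu⟩ := exists_unbounded_of_isDefective hq hd
  have ht0 : t ≠ 0 := by
    rintro rfl
    exact htu ⟨0, fun k => by simp⟩
  obtain ⟨z, c, hz⟩ := hL t ht ht0
  exact hx0 (hM.eq_zero_of_recurrent_of_unbounded hs
    (hM.subset_of_linStable_of_isDefective hq hd hs) ht hz htu hx (hrec l hw))

theorem norm_lt_of_attractive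
    (hM : InvariantCone (scaledEnd G q) (reEigenspace G q) (reOtherSpace G q) M) (hq : q ≠ 0)
    (hs : LinStable (scaledEnd G q) M) (ha : LinAttractive (scaledEnd G q) M) :
    ∀ p ∈ spectrum ℂ (toComplex G) \ {q, starRingEnd ℂ q}, ‖p‖ < ‖q‖ := by
  intro p hp
  refine lt_of_le_of_ne (hM.spectrum_of_linStable hq hs p hp).1 fun heq => ?_
  obtain ⟨w, x, hx, hx0, hrec⟩ := exists_recurrent_of_norm_eq hq heq hp
  obtain ⟨l, hl, hle, hw, hL, -⟩ := exists_returnTimes (G := G) hq w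
  exact hx0 (hM.eq_zero_of_recurrent_of_attractive ha hle hL hx (hrec l hw))

theorem linStable_of_not_isDefective
    (hM : InvariantCone (scaledEnd G q) (reEigenspace G q) (reOtherSpace G q) M) (hq : q ≠ 0)
    (hd : ¬ IsDefective G q) (hle : ∀ p ∈ spectrum ℂ (toComplex G), ‖p‖ ≤ ‖q‖)
    (hnd : ∀ p ∈ spectrum ℂ (toComplex G) \ {q, starRingEnd ℂ q},
      ‖p‖ = ‖q‖ → ¬ IsDefective G p) : LinStable (scaledEnd G q) M := by
  obtain ⟨C, hC⟩ := exists_power_bound (G := G) hq hle fun p hp heq => by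
    by_cases hpq : p ∈ ({q, starRingEnd ℂ q} : Set ℂ)
    · rcases hpq with rfl | rfl
      · exact hd
      · exact not_isDefective_conj hd
    · exact hnd p ⟨hp, hpq⟩ heq
  obtain ⟨c, hc, hcE⟩ := exists_lower_bound hq hd
  exact hM.linStable_of_bounded hc hC fun k x hx => hcE k x (hM.subset hx)

theorem linStable_of_subset
    (hM : InvariantCone (scaledEnd G q) (reEigenspace G q) (reOtherSpace G q) M) (hq : q ≠ 0)
    (hE : (reEigenspace G q : Set (EuclideanSpace ℝ (Fin n))) ⊆ M)
    (hlt : ∀ p ∈ spectrum ℂ (toComplex G) \ {q, starRingEnd ℂ q}, ‖p‖ < ‖q‖) :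
    LinStable (scaledEnd G q) M := by
  obtain ⟨C, η, hη0, hη1, hdom⟩ := exists_domination (G := G) hq hlt
  exact hM.linStable_of_dominated hE hη0 hη1 hdom

theorem subset_or_real_of_attractive
    (hM : InvariantCone (scaledEnd G q) (reEigenspace G q) (reOtherSpace G q) M) (hq : q ≠ 0)
    (hqs : q ∈ spectrum ℂ (toComplex G))
    (hs : LinStable (scaledEnd G q) M) (ha : LinAttractive (scaledEnd G q) M) :
    (reEigenspace G q : Set (EuclideanSpace ℝ (Fin n))) ⊆ M ∨
      ((∃ a : ℝ, 0 < a ∧ q = (a : ℂ)) ∧ algMult G q = 1) := by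
  by_cases hd : IsDefective G q
  · exact Or.inl (hM.subset_of_linStable_of_isDefective hq hd hs)
  by_cases hE : 1 < finrank ℝ (reEigenspace G q)
  · left
    obtain ⟨l, hl, hle, -, -, hrec⟩ := exists_returnTimes (G := G) hq 1
    exact hM.subset_of_attractive ha hle (hrec hd) hE
  obtain ⟨hreal, h1⟩ := real_and_simple_of_finrank_le_one hqs (not_lt.1 hE)
  obtain ⟨a, ha'⟩ := Complex.conj_eq_iff_real.1 hreal
  have ha0 : a ≠ 0 := by
    rintro rfl
    exact hq (by simpa using ha')
  rcases lt_or_gt_of_ne ha0 with hneg | hpos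
  · left
    obtain ⟨m, hm, hm0⟩ := hM.exists_ne
    have hline := exists_smul_of_algMult_eq_one hreal h1 m (hM.subset hm) hm0
    rw [isDefective_iff, not_not] at hd
    obtain ⟨v, hv, rfl⟩ := mem_reEigenspace.1 (hM.subset hm)
    -- For negative `q` the scaled map is a reflection of the line, so the invariant cone contains
    -- both rays.
    have hneg' : scaledEnd G q (reVec v) = -reVec v := by
      have h2 := scaledEnd_pow_reVec' (G := G) q 1 v
      rw [pow_one, pow_one, pow_one, End.mem_eigenspace_iff.1 (hd hv), ha', reVec_real_smul,
        smul_smul, Complex.norm_real, Real.norm_of_nonpos hneg.le] at h2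
      rw [ha', h2]
      have : (-a)⁻¹ * a = -1 := by field_simp
      rw [this, neg_one_smul]
    have hnm := hM.map _ hm
    rw [hneg'] at hnm
    intro e he
    obtain ⟨c, rfl⟩ := hline e he
    rcases le_total 0 c with hc | hc
    · exact hM.smul_mem _ hm c hc
    · have := hM.smul_mem _ hnm (-c) (by linarith)
      rwa [smul_neg, neg_smul, neg_neg] at this
  · exact Or.inr ⟨⟨a, hpos, ha'⟩, h1⟩

theorem linAttractive_of_subset_or_real
    (hM : InvariantCone (scaledEnd G q) (reEigenspace G q) (reOtherSpace G q) M) (hq : q ≠ 0)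
    (hlt : ∀ p ∈ spectrum ℂ (toComplex G) \ {q, starRingEnd ℂ q}, ‖p‖ < ‖q‖)
    (hE : (reEigenspace G q : Set (EuclideanSpace ℝ (Fin n))) ⊆ M ∨
      ((∃ a : ℝ, 0 < a ∧ q = (a : ℂ)) ∧ algMult G q = 1)) :
    LinAttractive (scaledEnd G q) M := by
  obtain ⟨C, η, hη0, hη1, hdom⟩ := exists_domination (G := G) hq hlt
  rcases hE with hE | ⟨⟨a, -, rfl⟩, h1⟩
  · exact hM.linAttractive_of_dominated one_pos (fun e he _ _ _ => hE he) hη0 hη1 hdom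
  · obtain ⟨δ, hδ, hmem⟩ := hM.exists_component_mem
      (fun m hm hm0 e he => exists_smul_of_algMult_eq_one (Complex.conj_ofReal a) h1 m hm hm0 e he)
    exact hM.linAttractive_of_dominated hδ hmem hη0 hη1 hdom

end InvariantCone

theorem reEigenspace_subset_of_eigenvectors (hd : ¬ IsDefective G q) (h0 : (0 : _) ∈ M)
    (hv : ∀ v : Fin n → ℂ, v ≠ 0 → (toComplex G).mulVec v = q • v →
      (rspan v : Set (EuclideanSpace ℝ (Fin n))) ⊆ M) :
    (reEigenspace G q : Set (EuclideanSpace ℝ (Fin n))) ⊆ M := by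
  rw [isDefective_iff, not_not] at hd
  intro x hx
  obtain ⟨v, hvq, rfl⟩ := mem_reEigenspace.1 hx
  by_cases hv0 : v = 0
  · rw [hv0, map_zero]; exact h0
  · exact hv v hv0 (End.mem_eigenspace_iff.1 (hd hvq)) (reVec_mem_rspan v)

theorem rspan_subset_of_reEigenspace_subset
    (hE : (reEigenspace G q : Set (EuclideanSpace ℝ (Fin n))) ⊆ M) (v : Fin n → ℂ)
    (hv : (toComplex G).mulVec v = q • v) : (rspan v : Set (EuclideanSpace ℝ (Fin n))) ⊆ M :=
  Set.Subset.trans (rspan_le_reEigenspace (End.eigenspace_le_maxGenEigenspace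
    (End.mem_eigenspace_iff.2 hv))) hE

theorem nnnorm_eq_spectralRadius_iff (hq : q ∈ spectrum ℂ (toComplex G)) :
    (‖q‖₊ : ENNReal) = spectralRadius ℂ (toComplex G) ↔
      ∀ p ∈ spectrum ℂ (toComplex G), ‖p‖ ≤ ‖q‖ := by
  constructor
  · intro h p hp
    have h1 : (‖p‖₊ : ENNReal) ≤ spectralRadius ℂ (toComplex G) :=
      le_iSup₂ (f := fun (k : ℂ) (_ : k ∈ spectrum ℂ (toComplex G)) => (‖k‖₊ : ENNReal)) p hp
    rw [← h] at h1
    exact_mod_cast h1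
  · intro h
    refine le_antisymm
      (le_iSup₂ (f := fun (k : ℂ) (_ : k ∈ spectrum ℂ (toComplex G)) => (‖k‖₊ : ENNReal)) q hq)
      (iSup₂_le fun p hp => ?_)
    exact_mod_cast h p hp

theorem norm_le_of_forall_other
    (h : ∀ p ∈ spectrum ℂ (toComplex G) \ {q, starRingEnd ℂ q}, ‖p‖ ≤ ‖q‖) :
    ∀ p ∈ spectrum ℂ (toComplex G), ‖p‖ ≤ ‖q‖ := by
  intro p hp
  by_cases hpq : p ∈ ({q, starRingEnd ℂ q} : Set ℂ)
  · rcases hpq with rfl | rfl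
    · exact le_rfl
    · rw [RCLike.norm_conj]
  · exact h p ⟨hp, hpq⟩

end LinearCriteria

/-! ### The gamma map inside one region. -/

section Gamma

variable {n m r : ℕ} {S : System n m r} {i : Fin r}

theorem gamma_eq_normalize {x : EuclideanSpace ℝ (Fin n)} (hx : x ≠ 0) (hi : x ∈ S.R i) :
    S.gamma x = NormedSpace.normalize (realEnd (S.G i) x) :=
  S.gamma_of_mem hx hi

theorem realEnd_pow_apply (G : Matrix (Fin n) (Fin n) ℝ) (k : ℕ) (x : EuclideanSpace ℝ (Fin n)) :
    (realEnd G ^ k) x = WithLp.toLp 2 ((G ^ k).mulVec x.ofLp) := by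
  induction k with
  | zero => simp
  | succ k ih =>
    rw [pow_succ', End.mul_apply, ih, realEnd_apply, pow_succ', ← Matrix.mulVec_mulVec]

theorem pos_of_ne_zero {x : EuclideanSpace ℝ (Fin n)} (hx : x ≠ 0) : 1 ≤ n := by
  rcases Nat.eq_zero_or_pos n with rfl | hn
  · exact absurd (Subsingleton.elim x 0) hx
  · exact hn

theorem realEnd_pow_ne_zero {x : EuclideanSpace ℝ (Fin n)} (hx : x ≠ 0) (hi : x ∈ S.R i) {k : ℕ}
    (hk : 1 ≤ k) (hkn : k ≤ n) : (realEnd (S.G i) ^ k) x ≠ 0 := by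
  intro h0
  have hmem : x ∈ {x : EuclideanSpace ℝ (Fin n) |
      (stepMatrix S.A S.B S.K (S.τ i) ^ k).mulVec x.ofLp = 0} ∩ S.R i := by
    refine ⟨?_, hi⟩
    rw [realEnd_pow_apply] at h0
    exact congrArg WithLp.ofLp h0
  rw [S.null_inter i k hk hkn] at hmem
  exact hx hmem

theorem realEnd_ne_zero {x : EuclideanSpace ℝ (Fin n)} (hx : x ≠ 0) (hi : x ∈ S.R i) :
    realEnd (S.G i) x ≠ 0 := by
  simpa using realEnd_pow_ne_zero hx hi le_rfl (pos_of_ne_zero hx)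

/-- A generalized eigenvector for zero is killed by the `n`-th power, which the kernel condition
with `l = n` excludes. -/
theorem eigenvalue_ne_zero {x : EuclideanSpace ℝ (Fin n)} (hx : x ≠ 0) (hi : x ∈ S.R i) {q : ℂ}
    (hE : x ∈ reEigenspace (S.G i) q) : q ≠ 0 := by
  rintro rfl
  obtain ⟨v, hv, rfl⟩ := mem_reEigenspace.1 hE
  refine realEnd_pow_ne_zero hx hi (pos_of_ne_zero hx) le_rfl ?_
  rw [End.maxGenEigenspace_eq_genEigenspace_finrank, finrank_fin_fun,
    End.mem_genEigenspace_nat, LinearMap.mem_ker, zero_smul, sub_zero] at hv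
  have h1 := pow_reVec_eq (B := realEnd (S.G i)) (A := complexEnd (S.G i)) (c := 1)
    (fun v => by rw [one_smul, reVec_complexEnd]) n v
  rw [h1, hv, smul_zero, map_zero]

end Gamma

end STC

/-! ### The main theorem. -/

open STC in
theorem mainTheorem1 {n m r : ℕ} (S : STC.System n m r) (i : Fin r)
    (hsolid : (interior (S.R i)).Nonempty)
    (Rbar : Set (EuclideanSpace ℝ (Fin n))) (hcone : STC.IsCone Rbar) (hclosed : IsClosed Rbar)
    (hpis : S.IsPIS i Rbar) (hint : Rbar \ {0} ⊆ interior (S.R i))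
    (μ : ℂ) (hμ : μ ∈ spectrum ℂ (STC.toComplex (S.G i)))
    (M : Set (EuclideanSpace ℝ (Fin n)))
    (hM : M = Rbar ∩ (STC.realGenEigenspace (S.G i) μ : Set (EuclideanSpace ℝ (Fin n))))
    (Mhat : Set (EuclideanSpace ℝ (Fin n)))
    (hMhat : Mhat = M ∩ Metric.sphere 0 1) :
    S.IsPIS i M ∧ S.PositivelyInvariant Mhat ∧ (M ≠ {0} ↔ Mhat ≠ ∅) ∧
    (M ≠ {0} →
      (¬ STC.IsDefective (S.G i) μ →
        (STC.IsStableSet S.gamma Mhat ↔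
          (‖μ‖₊ : ENNReal) = spectralRadius ℂ (STC.toComplex (S.G i)) ∧
          ∀ q ∈ spectrum ℂ (STC.toComplex (S.G i)) \ {μ, (starRingEnd ℂ) μ},
            ‖q‖ = ‖μ‖ → ¬ STC.IsDefective (S.G i) q)) ∧
      (STC.IsDefective (S.G i) μ →
        (STC.IsStableSet S.gamma Mhat ↔
          (‖μ‖₊ : ENNReal) = spectralRadius ℂ (STC.toComplex (S.G i)) ∧
          (STC.realGenEigenspace (S.G i) μ : Set (EuclideanSpace ℝ (Fin n))) ⊆ M ∧
          ∀ q ∈ spectrum ℂ (STC.toComplex (S.G i)) \ {μ, (starRingEnd ℂ) μ}, ‖q‖ < ‖μ‖)) ∧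
      (STC.IsAsympStableSet S.gamma Mhat ↔
        STC.IsStableSet S.gamma Mhat ∧
        (∀ q ∈ spectrum ℂ (STC.toComplex (S.G i)) \ {μ, (starRingEnd ℂ) μ}, ‖q‖ < ‖μ‖) ∧
        ((∀ v : Fin n → ℂ, v ≠ 0 → (STC.toComplex (S.G i)).mulVec v = μ • v →
            (STC.rspan v : Set (EuclideanSpace ℝ (Fin n))) ⊆ M) ∨
          ((∃ a : ℝ, 0 < a ∧ μ = (a : ℂ)) ∧ STC.algMult (S.G i) μ = 1))) ∧
      (STC.IsUnstableSet S.gamma Mhat ↔ ¬ STC.IsStableSet S.gamma Mhat)) := by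
  rw [realGenEigenspace_eq] at hM ⊢
  have hgamma : ∀ x ∈ M, x ≠ 0 → S.gamma x ∈ M := by
    intro x hx hx0
    rw [hM] at hx ⊢
    refine ⟨hpis.2 x hx.1 hx0, ?_⟩
    rw [gamma_eq_normalize hx0 (hpis.1 hx.1)]
    exact Submodule.smul_mem _ _ (realEnd_mem_reEigenspace x hx.2)
  have hsub : M ⊆ S.R i := by
    rw [hM]; exact Set.inter_subset_left.trans hpis.1
  have hsmul : ∀ x ∈ M, ∀ c : ℝ, 0 ≤ c → c • x ∈ M := by
    intro x hx c hc
    rw [hM] at hx ⊢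
    exact ⟨hcone.2 x hx.1 c hc, Submodule.smul_mem _ _ hx.2⟩
  have h0M : (0 : EuclideanSpace ℝ (Fin n)) ∈ M := by
    obtain ⟨x, hx⟩ := hcone.1
    rw [hM]
    exact ⟨by simpa using hcone.2 x hx 0 le_rfl, Submodule.zero_mem _⟩
  have hexists : M ≠ {0} → ∃ x ∈ M, x ≠ 0 := by
    intro hne
    by_contra! hcon
    exact hne (Set.eq_singleton_iff_unique_mem.2 ⟨h0M, hcon⟩)
  refine ⟨⟨hsub, hgamma⟩, ?_, ?_, ?_⟩
  · rintro x hx hx0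
    rw [hMhat] at hx ⊢
    refine ⟨hgamma x hx.1 hx0, ?_⟩
    rw [gamma_eq_normalize hx0 (hsub hx.1), mem_sphere_zero_iff_norm]
    exact NormedSpace.norm_normalize (realEnd_ne_zero hx0 (hsub hx.1))
  · constructor
    · intro hne
      obtain ⟨x, hx, hx0⟩ := hexists hne
      rw [← Set.nonempty_iff_ne_empty, hMhat]
      exact ⟨NormedSpace.normalize x, hsmul x hx _ (by positivity),
        mem_sphere_zero_iff_norm.2 (NormedSpace.norm_normalize hx0)⟩
    · rintro hne rfl
      obtain ⟨x, hx⟩ := Set.nonempty_iff_ne_empty.2 hne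
      rw [hMhat] at hx
      have h1 : ‖x‖ = 1 := mem_sphere_zero_iff_norm.1 hx.2
      rw [Set.mem_singleton_iff.1 hx.1, norm_zero] at h1
      exact zero_ne_one h1
  intro hne
  obtain ⟨x, hx, hx0⟩ := hexists hne
  have hME : M ⊆ reEigenspace (S.G i) μ := by
    rw [hM]; exact Set.inter_subset_right
  have hμ0 : μ ≠ 0 := eigenvalue_ne_zero hx0 (hsub hx) (hME hx)
  have hμpos : 0 < ‖μ‖⁻¹ := inv_pos.2 (norm_pos_iff.2 hμ0)
  have hIC : InvariantCone (scaledEnd (S.G i) μ) (reEigenspace (S.G i) μ)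
      (reOtherSpace (S.G i) μ) M :=
    { isCompl := isCompl_reEigenspace μ
      mapE := scaledEnd_mem realEnd_mem_reEigenspace
      mapF := scaledEnd_mem realEnd_mem_reOtherSpace
      inj := fun x hx h0 => eq_zero_of_realEnd_eq_zero hμ0 x hx
        ((smul_eq_zero_iff_right hμpos.ne').1 h0)
      isClosed := by
        rw [hM]; exact hclosed.inter (Submodule.closed_of_finiteDimensional _)
      smul_mem := hsmul
      subset := hME
      map := by
        intro x hx
        by_cases hx0 : x = 0
        · rw [hx0, map_zero]; exact h0M
        · have h1 := hgamma x hx hx0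
          rw [gamma_eq_normalize hx0 (hsub hx)] at h1
          -- The scaled linear image is a nonnegative multiple of `γ x`, so invariance of the cone
          -- under `γ` gives invariance under `h`.
          have h2 := hsmul _ h1 (‖μ‖⁻¹ * ‖realEnd (S.G i) x‖) (by positivity)
          rwa [mul_smul, NormedSpace.norm_smul_normalize] at h2
      exists_ne := ⟨x, hx, hx0⟩ }
  have hopen : IsOpen (interior (S.R i) \ {0}) := isOpen_interior.sdiff isClosed_singleton
  have hMU : M ∩ Metric.sphere 0 1 ⊆ interior (S.R i) \ {0} := by
    rintro x ⟨hx, hx1⟩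
    have hx0 : x ≠ 0 := by
      rintro rfl
      simp at hx1
    rw [hM] at hx
    exact ⟨hint ⟨hx.1, hx0⟩, hx0⟩
  have hf : ∀ x ∈ interior (S.R i) \ {0},
      S.gamma x = NormedSpace.normalize (scaledEnd (S.G i) μ x) := by
    rintro x ⟨hx, hx0⟩
    rw [gamma_eq_normalize hx0 (interior_subset hx), scaledEnd, LinearMap.smul_apply,
      NormedSpace.normalize_smul_of_pos hμpos]
  rw [hMhat, isStableSet_iff hIC hopen hMU hf, isAsympStableSet_iff hIC hopen hMU hf,
    isUnstableSet_iff, isStableSet_iff hIC hopen hMU hf, nnnorm_eq_spectralRadius_iff hμ]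
  refine ⟨fun hd => ⟨fun hs => ?_, fun h => ?_⟩, fun hd => ⟨fun hs => ?_, fun h => ?_⟩,
    ⟨fun ⟨hs, ha⟩ => ?_, fun ⟨hs, hlt, hE⟩ => ⟨hs, ?_⟩⟩, Iff.rfl⟩
  · have h1 := hIC.spectrum_of_linStable hμ0 hs
    exact ⟨norm_le_of_forall_other fun q hq => (h1 q hq).1, fun q hq => (h1 q hq).2⟩
  · exact hIC.linStable_of_not_isDefective hμ0 hd h.1 h.2
  · exact ⟨norm_le_of_forall_other fun q hq => (hIC.spectrum_of_linStable hμ0 hs q hq).1,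
      hIC.subset_of_linStable_of_isDefective hμ0 hd hs,
      hIC.norm_lt_of_linStable_of_isDefective hμ0 hd hs⟩
  · exact hIC.linStable_of_subset hμ0 h.2.1 h.2.2
  · refine ⟨hs, hIC.norm_lt_of_attractive hμ0 hs ha, ?_⟩
    exact (hIC.subset_or_real_of_attractive hμ0 hμ hs ha).imp_left
      fun hE v _ hv => rspan_subset_of_reEigenspace_subset hE v hv
  · refine hIC.linAttractive_of_subset_or_real hμ0 hlt (hE.imp_left fun hv => ?_)
    -- Condition (a) concerns eigenvectors only. For defective `μ` the inclusion of the whole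
    -- generalized eigenspace comes from stability instead.
    by_cases hd : IsDefective (S.G i) μ
    · exact hIC.subset_of_linStable_of_isDefective hμ0 hd hs
    · exact reEigenspace_subset_of_eigenvectors hd h0M hv
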